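/- Let $F$ be a commutative ring, $\Omega$ a set, $n\ge 0$, and $P=F[x_\omega]_{\omega\in\Omega}$, with augmentation ideal $P^+=\ker(x_\omega\mapsto 0)$. For a commutative $F$-algebra $A$ let $TS^n(A)=(A^{\otimes n})^{S_n}$ and, for $a\in A$, let $e_k^n(a)\in TS^n(A)$ be the $k$-th elementary symmetric polynomial in $n$ variables evaluated at $a\otimes 1\otimes\cdots\otimes 1,\ \dots,\ 1\otimes\cdots\otimes 1\otimes a$ (so $e_k^n(a)=0$ for $k>n$); the same formula over every commutative $F$-algebra $L$ gives the polynomial law $e_k^n$. Let $E=F[e_{i,\mu}]$ be the polynomial ring on symbols $e_{i,\mu}$ with $i\ge 1$ and $\mu$ a monomial in the $x_\omega$ with coprime exponents, and let $\kappa_n:E\to TS^n(P)$ be the $F$-algebra homomorphism with $e_{i,\mu}\mapsto e_i^n(\mu)$ for $i\le n$ and $e_{i,\mu}\mapsto 0$ for $i>n$. Theorem (Relations). The homomorphism $\kappa_n$ is surjective. For every $m\ge 0$ there is a unique polynomial law $\overline e_m:P^+\to E$ such that, for every commutative $F$-algebra $L$ and every $f\in L\otimes P^+$, $\kappa_N(\overline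 e_m(f))=e_m^N(f)$ in $L\otimes P^{\otimes N}$ for all sufficiently large $N$; it is homogeneous of degree $m$. By the coefficients of $\overline e_m$ we mean the elements $\overline e_{m,\xi}(a_1,\dots,a_r)\in E$ in the expansions $\overline e_m(\sum_{s=1}^r t_s\otimes a_s)=\sum_{\xi\in\mathbb N^r} t^\xi\otimes \overline e_{m,\xi}(a_1,\dots,a_r)$ over $F[t_1,\dots,t_r]$, with $r\in\mathbb N$ and $a_1,\dots,a_r\in P^+$. For an ideal $I\subseteq P$ choose, for each $1\le k\le n$ and each $g\in I$, an arbitrary lifting to $E$ of $e_k^n(g)\in TS^n(P)$ along $\kappa_n$. Then: 1. Let $I\subseteq P$ be an ideal such that $A=P/I$ is flat over $F$. Then the composite $E\xrightarrow{\kappa_n}TS^n(P)\to TS^n(A)$ is surjective, and its kernel is the sum of the $F$-linear span of the coefficients of all $\overline e_m$ with $m>n$ and of the ideal of $E$ generated by the chosen liftings of the $e_k^n(g)$ with $1\le k\le n$ and $g\in I$. 2. If $F$ is an infinite field, then $\ker\kappa_n$ is generated as an ideal by the elements $\overline e_m(f)$ with $m>n$ and $f\in P^+$. 3. If $F$ is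 an infinite field and $I\subseteq P$ is any ideal, then the kernel of $E\xrightarrow{\kappa_n}TS^n(P)\to TS^n(P/I)$ is generated as an ideal by the elements $\overline e_m(f)$ with $m>n$ and $f\in P^+$ together with the chosen liftings of the $e_k^n(g)$ with $1\le k\le n$ and $g\in I$. -/

import Mathlib

open scoped TensorProduct

noncomputable section

namespace SymProd

universe u v w w'

section Tensors

variable (F : Type u) [CommRing F] (n : ℕ) (A : Type v) [CommRing A] [Algebra F A]
  (B : Type w) [CommRing B] [Algebra F B]

/-- The `n`-th tensor power `A ⊗ ⋯ ⊗ A` over `F`, a commutative `F`-algebra. -/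
abbrev TPow : Type _ := ⨂[F] _ : Fin n, A

/-- The action of a permutation on the tensor power,
`a₁ ⊗ ⋯ ⊗ aₙ ↦ a_{σ 1} ⊗ ⋯ ⊗ a_{σ n}`. -/
def permHom (σ : Equiv.Perm (Fin n)) : TPow F n A →ₐ[F] TPow F n A :=
  PiTensorProduct.liftAlgHom
    ((PiTensorProduct.tprod F (s := fun _ : Fin n => A)).domDomCongr σ) rfl
    (fun x y => by
      simp only [MultilinearMap.domDomCongr_apply, PiTensorProduct.tprod_mul_tprod]
      rfl)

theorem permHom_tprod (σ : Equiv.Perm (Fin n)) (a : Fin n → A) :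
    permHom F n A σ (PiTensorProduct.tprod F a) = PiTensorProduct.tprod F (fun i => a (σ i)) :=
  PiTensorProduct.lift.tprod a

/-- The algebra `TSⁿ(A)` of symmetric tensors: the invariants of the symmetric group in the
`n`-th tensor power. -/
def TS : Subalgebra F (TPow F n A) where
  carrier := {x | ∀ σ : Equiv.Perm (Fin n), permHom F n A σ x = x}
  mul_mem' hx hy σ := by rw [map_mul, hx σ, hy σ]
  add_mem' hx hy σ := by rw [map_add, hx σ, hy σ]
  algebraMap_mem' r σ := AlgHom.commutes _ r

variable {A}

/-- `1 ⊗ ⋯ ⊗ a ⊗ ⋯ ⊗ 1`, with `a` in position `j`. -/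
abbrev ins (j : Fin n) : A →ₐ[F] TPow F n A :=
  PiTensorProduct.singleAlgHom (R := F) (A := fun _ : Fin n => A) j

theorem permHom_ins (σ : Equiv.Perm (Fin n)) (j : Fin n) (a : A) :
    permHom F n A σ (ins F n j a) = ins F n (σ.symm j) a := by
  simp only [PiTensorProduct.singleAlgHom_apply, permHom_tprod, MonoidHom.mulSingle_apply]
  congr 1
  funext i
  simp only [Pi.mulSingle, Function.update_apply, Equiv.eq_symm_apply, Pi.one_apply]

/-- `e_kⁿ(a)`: the `k`-th elementary symmetric polynomial in `n` variables, evaluated at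
`a ⊗ 1 ⊗ ⋯ ⊗ 1, …, 1 ⊗ ⋯ ⊗ 1 ⊗ a`. -/
def elemSym (k : ℕ) (a : A) : TS F n A :=
  ⟨MvPolynomial.aeval (fun j => ins F n j a) (MvPolynomial.esymm (Fin n) F k), by
    intro σ
    have h1 : (permHom F n A σ).comp (MvPolynomial.aeval (fun j => ins F n j a)) =
        (MvPolynomial.aeval (fun j => ins F n j a)).comp (MvPolynomial.rename (R := F) σ.symm) := by
      apply MvPolynomial.algHom_ext
      intro j
      simp only [AlgHom.comp_apply, MvPolynomial.aeval_X, MvPolynomial.rename_X, permHom_ins]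
    have h2 := DFunLike.congr_fun h1 (MvPolynomial.esymm (Fin n) F k)
    simp only [AlgHom.comp_apply] at h2
    rw [h2, MvPolynomial.esymm_isSymmetric (Fin n) F k σ.symm]⟩

/-- The polynomial law `e_kⁿ` from `A` to the `n`-th tensor power of `A`: on `L ⊗ A` it is the
`k`-th elementary symmetric polynomial evaluated at the `n` insertions
`L ⊗ A → L ⊗ (A ⊗ ⋯ ⊗ A)`. -/
def elemLaw (k : ℕ) : A →ₚₗ[F] TPow F n A where
  toFun' L _ _ z := MvPolynomial.aeval
    (fun j => Algebra.TensorProduct.map (AlgHom.id F L) (ins F n j) z)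
    (MvPolynomial.esymm (Fin n) F k)
  isCompat' {L _ _ L' _ _} f := by
    funext z
    have key : ∀ j : Fin n, Algebra.TensorProduct.map f (AlgHom.id F (TPow F n A))
          (Algebra.TensorProduct.map (AlgHom.id F L) (ins F n j) z) =
        Algebra.TensorProduct.map (AlgHom.id F L') (ins F n j)
          (Algebra.TensorProduct.map f (AlgHom.id F A) z) := by
      intro j
      induction z with
      | zero => simp only [map_zero]
      | tmul x y => simp only [Algebra.TensorProduct.map_tmul, AlgHom.id_apply]
      | add x y hx hy => simp only [map_add, hx, hy]
    have h := MvPolynomial.comp_aeval_apply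
      (fun j => Algebra.TensorProduct.map (AlgHom.id F L) (ins F n j) z)
      (Algebra.TensorProduct.map f (AlgHom.id F (TPow F n A)))
      (MvPolynomial.esymm (Fin n) F k)
    simp only [key] at h
    exact h

variable {B}

/-- The map `a₁ ⊗ ⋯ ⊗ aₙ ↦ f a₁ ⊗ ⋯ ⊗ f aₙ` of tensor powers. -/
def powMap (f : A →ₐ[F] B) : TPow F n A →ₐ[F] TPow F n B :=
  PiTensorProduct.liftAlgHom
    ((PiTensorProduct.tprod F (s := fun _ : Fin n => B)).compLinearMap
      (fun _ => f.toLinearMap))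
    (by
      simp only [MultilinearMap.compLinearMap_apply, Pi.one_apply, AlgHom.toLinearMap_apply,
        map_one]
      rfl)
    (fun x y => by
      simp only [MultilinearMap.compLinearMap_apply, PiTensorProduct.tprod_mul_tprod,
        Pi.mul_apply, AlgHom.toLinearMap_apply, map_mul]
      rfl)

theorem powMap_tprod (f : A →ₐ[F] B) (a : Fin n → A) :
    powMap F n f (PiTensorProduct.tprod F a) = PiTensorProduct.tprod F (fun i => f (a i)) := by
  simp [powMap]

theorem permHom_powMap (f : A →ₐ[F] B) (σ : Equiv.Perm (Fin n)) (x : TPow F n A) :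
    permHom F n B σ (powMap F n f x) = powMap F n f (permHom F n A σ x) := by
  induction x using PiTensorProduct.induction_on with
  | smul_tprod r a => simp only [map_smul, powMap_tprod, permHom_tprod]
  | add x y hx hy => simp only [map_add, hx, hy]

/-- `TSⁿ(f) : TSⁿ(A) → TSⁿ(B)`. -/
def tsMap (f : A →ₐ[F] B) : TS F n A →ₐ[F] TS F n B :=
  ((powMap F n f).comp (TS F n A).val).codRestrict (TS F n B) (fun x σ => by
    have := permHom_powMap F n f σ (x : TPow F n A)
    rw [x.2 σ] at this
    exact this)

end Tensors

section Laws

variable {F : Type u} [CommRing F] {M : Type w} [AddCommGroup M] [Module F M]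
  {N : Type w'} [AddCommGroup N] [Module F N]

/-- The coefficient `φ_ξ(a₁, …, a_r)` of a polynomial law: the coefficient of the monomial `x^ξ`
in `φ(x₁ ⊗ a₁ + ⋯ + x_r ⊗ a_r)`, where `φ` is taken over `F[x₁, …, x_r]`. -/
def lawCoeff (φ : M →ₚₗ[F] N) {r : ℕ} (a : Fin r → M) (ξ : Fin r →₀ ℕ) : N :=
  TensorProduct.lid F N ((MvPolynomial.lcoeff F ξ).rTensor N
    (φ.toFun' (MvPolynomial (Fin r) F) (∑ i, MvPolynomial.X i ⊗ₜ[F] a i)))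

/-- The polynomial law `φ` is homogeneous of degree `m`. -/
def IsHomogeneousLaw (m : ℕ) (φ : M →ₚₗ[F] N) : Prop :=
  ∀ (L : Type u) [CommSemiring L] [Algebra F L] (c : L) (z : L ⊗[F] M),
    φ.toFun' L (c • z) = c ^ m • φ.toFun' L z

end Laws

section Relations

variable (F : Type u) [CommRing F] (Ω : Type v)

/-- Monomials in the variables `x_ω` (given by their exponents) having coprime exponents; the
constant monomial is excluded since the gcd of the empty family is `0`. -/
abbrev PrimMon : Type v := {μ : Ω →₀ ℕ // μ.support.gcd μ = 1}

/-- The polynomial ring freely generated by the symbols `e_{i,μ}`, with `i ≥ 1` and `μ` a monomial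
with coprime exponents. -/
abbrev ERing : Type _ := MvPolynomial (ℕ+ × PrimMon Ω) F

/-- `κ_n : F[e_{i,μ}] → TSⁿ(F[x_ω])`, with `e_{i,μ} ↦ e_iⁿ(μ)` for `i ≤ n` and `e_{i,μ} ↦ 0` for
`i > n`. -/
def kappa (n : ℕ) : ERing F Ω →ₐ[F] TS F n (MvPolynomial Ω F) :=
  MvPolynomial.aeval (fun p : ℕ+ × PrimMon Ω =>
    if (p.1 : ℕ) ≤ n then elemSym F n (p.1 : ℕ) (MvPolynomial.monomial p.2.1 (1 : F)) else 0)

/-- The augmentation ideal of `F[x_ω]`: the kernel of the evaluation at `x_ω ↦ 0`. -/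
def augIdeal : Ideal (MvPolynomial Ω F) :=
  RingHom.ker (MvPolynomial.aeval (fun _ : Ω => (0 : F)) : MvPolynomial Ω F →ₐ[F] F)

/-- The inclusion of the augmentation ideal in `F[x_ω]`, as an `F`-linear map. -/
def augIncl : augIdeal F Ω →ₗ[F] MvPolynomial Ω F :=
  (augIdeal F Ω).subtype.restrictScalars F

variable {F Ω} in
/-- `φ` gives a stable expression of the laws `e_mⁿ` on the augmentation ideal as polynomials in the
`e_iⁿ(μ)`: for each `f` in `L ⊗ P⁺`, the polynomial `φ(f)` is sent to `e_mⁿ(f)` when its variables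
`e_{i,μ}` are replaced by the `e_iⁿ(μ)`, for all sufficiently large `n`. -/
def IsStableLaw (m : ℕ) (φ : augIdeal F Ω →ₚₗ[F] ERing F Ω) : Prop :=
  ∀ (L : Type u) [CommSemiring L] [Algebra F L] (z : L ⊗[F] augIdeal F Ω),
    ∃ n₀ : ℕ, ∀ n ≥ n₀,
      (((TS F n (MvPolynomial Ω F)).val.comp (kappa F Ω n)).toLinearMap.lTensor L) (φ.toFun' L z) =
        (elemLaw F n m).toFun' L ((augIncl F Ω).lTensor L z)

/-- The stable polynomial law `ē_m` from `P⁺` to `F[e_{i,μ}]`. The existence and the uniqueness of a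
law with the defining property are part of the theorem about it. -/
def stableLaw (m : ℕ) : augIdeal F Ω →ₚₗ[F] ERing F Ω :=
  Classical.epsilon (IsStableLaw m)

/-- The coefficients of the laws `ē_m` with `m > n`. -/
def stableCoeffs (n : ℕ) : Set (ERing F Ω) :=
  {y | ∃ m > n, ∃ (r : ℕ) (a : Fin r → augIdeal F Ω) (ξ : Fin r →₀ ℕ),
    y = lawCoeff (stableLaw F Ω m) a ξ}

/-- The values `ē_m(f)` with `m > n` and `f ∈ P⁺`. -/
def stableValues (n : ℕ) : Set (ERing F Ω) :=
  {y | ∃ m > n, ∃ f : augIdeal F Ω, y = (stableLaw F Ω m).ground f}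

variable {F Ω}

/-- The composite `F[e_{i,μ}] → TSⁿ(P) → TSⁿ(P / I)`, where `P = F[x_ω]`. -/
def kappaQuot (n : ℕ) (I : Ideal (MvPolynomial Ω F)) :
    ERing F Ω →ₐ[F] TS F n (MvPolynomial Ω F ⧸ I) :=
  (tsMap F n (Ideal.Quotient.mkₐ F I)).comp (kappa F Ω n)

/-- `lift k g` is a lifting of `e_kⁿ(g)` along `κ_n`, for `1 ≤ k ≤ n` and `g ∈ I`. -/
def IsLifting (n : ℕ) (I : Ideal (MvPolynomial Ω F)) (lift : ℕ → MvPolynomial Ω F → ERing F Ω) :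
    Prop :=
  ∀ k, 1 ≤ k → k ≤ n → ∀ g ∈ I, kappa F Ω n (lift k g) = elemSym F n k g

/-- The chosen liftings of the `e_kⁿ(g)` with `1 ≤ k ≤ n` and `g ∈ I`. -/
def liftSet (n : ℕ) (I : Ideal (MvPolynomial Ω F)) (lift : ℕ → MvPolynomial Ω F → ERing F Ω) :
    Set (ERing F Ω) :=
  {y | ∃ k, 1 ≤ k ∧ k ≤ n ∧ ∃ g ∈ I, y = lift k g}

end Relations

end SymProd

end

/-! The engine is the norm of power series, `normSeries`: the product of the images of a series
under the `n` insertions. It is multiplicative, and the norm of `1 + zt` is `∑ e_k(z) t^k`. Hence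
the series with constant term 1 whose higher norm coefficients lie in a fixed non-unital subring
form a `t`-adically closed monoid. Every element of `1 + tV⟦t⟧` is an infinite product of factors `1
+ g t^w`, with `g` taken from an additive generating set of the ideal `V`. So if the `e_k(g)` of
generators lie in the subring, the `e_k` of all of `V` do (`coeff_normSeries_mem`, `esum_mem`).

This principle is used three times. For `V = L ⊗ P⁺` and families indexed by all `n`, it expresses
`e_k(z)` stably through elements of `L ⊗ E`; powers of a primitive monomial are treated by factoring
`1 - x^k t^k` over a ring with roots of unity and projecting back. For a single `n` it puts the
norms of all of `L ⊗ P` in the range of `κ_n`. For `V` extended from `I`, it shows that `e_k(f)`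
modulo the ideal of the `e_j(g)` depends only on `f` modulo `I` (`esum_sub_esum_mem`).

Suitable coefficients of the stable expressions are elements `M_α` of `E` mapping to the monomial
multisymmetric functions. In one multidegree the finitely many `M_α` and the monomials of `E` have
the same index set, so for large `n` a one-sided inverse of the transition matrix is two-sided
(`exists_block`). Therefore elements of `L ⊗ E` are detected by large `n`, which makes the stable
law unique and compatible with base change, and the `M_α` span `E`. Under `κ_n` those with `|α| ≤ n`
stay independent and the others die, which gives the kernel (`ker_kappa`).

For flat `P/I`, the equational criterion provides a linear `φ : P → P`, congruent to the identity
modulo `I`, killing any given finite part of `I`. Its tensor power kills a given kernel element `x`;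
thus `x = x - φ^{⊗n} x`, which is a combination of differences covered by `esum_sub_esum_mem`. The
same device makes preimages symmetric. Over an infinite field, coefficients of a law are
combinations of its values. -/

noncomputable section

namespace SymProd

universe u v w w'

/-! ### Norms of power series and the multiplicative closure principle. -/

section PowerSeries

open PowerSeries

/-- A `t`-adically closed multiplicative set of power series which contains all `1 + g t ^ w`,
for `g` in an additive generating set of an ideal `V`, contains `1 + t V⟦t⟧`. -/
theorem mem_of_one_add_mem {B : Type*} [CommRing B] (S : Submonoid B⟦X⟧) (V : Ideal B)
    (G : Set B) (hGV : G ⊆ V) (hVG : (V : Set B) ⊆ AddSubmonoid.closure G)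
    (hclosed : ∀ f : B⟦X⟧, (∀ d : ℕ, ∃ g ∈ S, X ^ d ∣ f - g) → f ∈ S)
    (hS : ∀ g ∈ G, ∀ w : ℕ, 1 + C g * X ^ (w + 1) ∈ S)
    (f : B⟦X⟧) (h0 : constantCoeff f = 1) (hf : map (Ideal.Quotient.mk V) f = 1) : f ∈ S := by
  -- Modulo `t^(w+2)` the product of `1 + x t^(w+1)` and `1 + y t^(w+1)` is `1 + (x+y) t^(w+1)`, so
  -- sums of generators also occur as leading terms.
  have step : ∀ w : ℕ, ∀ v ∈ AddSubmonoid.closure G,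
      ∃ u ∈ S, X ^ (w + 2) ∣ u - (1 + C v * X ^ (w + 1)) ∧
        map (Ideal.Quotient.mk V) u = 1 := by
    intro w v hv
    induction hv using AddSubmonoid.closure_induction with
    | mem x hx =>
      refine ⟨_, hS x hx w, by simp, ?_⟩
      have : Ideal.Quotient.mk V x = 0 := Ideal.Quotient.eq_zero_iff_mem.2 (hGV hx)
      simp [this]
    | zero => exact ⟨1, S.one_mem, by simp, by simp⟩
    | add x y _ _ hx hy =>
      obtain ⟨a, ha, ⟨a', ha'⟩, ha1⟩ := hx
      obtain ⟨b, hb, ⟨b', hb'⟩, hb1⟩ := hy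
      refine ⟨a * b, S.mul_mem ha hb, ?_, by simp [ha1, hb1]⟩
      rw [sub_eq_iff_eq_add] at ha' hb'
      refine ⟨a' * b + (1 + C x * X ^ (w + 1)) * b' + C x * C y * X ^ w, ?_⟩
      rw [ha', hb', map_add]
      ring
  refine hclosed f fun d => ?_
  -- The approximant must be trivial modulo `V`, so that the next error coefficient lies in `V`; the
  -- exponent `d + 1` lets the induction start from equal constant terms.
  suffices ∃ g ∈ S, X ^ (d + 1) ∣ f - g ∧ map (Ideal.Quotient.mk V) g = 1 by
    obtain ⟨g, hg, hd, -⟩ := this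
    exact ⟨g, hg, (pow_dvd_pow _ (Nat.le_succ d)).trans hd⟩
  induction d with
  | zero =>
    refine ⟨1, S.one_mem, ?_, by simp⟩
    rw [zero_add, pow_one, X_dvd_iff, map_sub, h0, map_one, sub_self]
  | succ d ih =>
    obtain ⟨g, hg, ⟨q, hq⟩, hg1⟩ := ih
    have hv : constantCoeff q ∈ V := by
      have h1 : map (Ideal.Quotient.mk V) (f - g) = 0 := by rw [map_sub, hf, hg1, sub_self]
      have h2 := congrArg (coeff (d + 1)) h1
      rw [hq, mul_comm, coeff_map, map_zero, coeff_mul_X_pow', if_pos le_rfl, Nat.sub_self,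
        coeff_zero_eq_constantCoeff_apply] at h2
      exact Ideal.Quotient.eq_zero_iff_mem.1 h2
    obtain ⟨u, hu, ⟨r, hr⟩, hu1⟩ := step d _ (hVG hv)
    refine ⟨g * u, S.mul_mem hg hu, ?_, by simp [hg1, hu1]⟩
    have hgc : constantCoeff g = 1 := by
      have := congrArg constantCoeff hq
      simp [h0] at this
      rw [sub_eq_zero] at this
      exact this.symm
    obtain ⟨g', hg'⟩ : X ∣ g - 1 := by rw [X_dvd_iff, map_sub, hgc, map_one, sub_self]
    obtain ⟨q', hq'⟩ : X ∣ q - C (constantCoeff q) := by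
      rw [X_dvd_iff, map_sub, constantCoeff_C, sub_self]
    refine ⟨q' - g * r - C (constantCoeff q) * g', ?_⟩
    have e1 : f = g + X ^ (d + 1) * q := by rw [← hq]; ring
    have e2 : u = X ^ (d + 2) * r + (1 + C (constantCoeff q) * X ^ (d + 1)) := by
      rw [← hr]; ring
    have e3 : g = 1 + X * g' := by rw [← hg']; ring
    have e4 : q = C (constantCoeff q) + X * q' := by rw [← hq']; ring
    rw [e1, e2]
    linear_combination X ^ (d + 1) * e4 + (C (constantCoeff q) * X ^ (d + 1)) * (-e3)

variable {B : Type*} [CommRing B] {R : Type*} [CommRing R] {n : ℕ}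

/-- The product of the images of a power series under finitely many ring homomorphisms. -/
def normSeries (σ : Fin n → B →+* R) : B⟦X⟧ →* R⟦X⟧ where
  toFun f := ∏ j, map (σ j) f
  map_one' := by simp
  map_mul' f g := by simp [Finset.prod_mul_distrib]

/-- The `k`-th elementary symmetric polynomial in the images of an element under finitely many
ring homomorphisms. -/
def esum (σ : Fin n → B →+* R) (k : ℕ) (z : B) : R :=
  ∑ T ∈ Finset.powersetCard k (Finset.univ : Finset (Fin n)), ∏ j ∈ T, σ j z

theorem normSeries_one_add (σ : Fin n → B →+* R) (z : B) (w : ℕ) :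
    normSeries σ (1 + C z * X ^ w) =
      ∑ k ∈ Finset.range (n + 1), C (esum σ k z) * X ^ (w * k) := by
  have h := Finset.prod_one_add (s := (Finset.univ : Finset (Fin n)))
    (f := fun j => (C (σ j z) : R⟦X⟧) * X ^ w)
  have h2 := Finset.sum_powerset (s := (Finset.univ : Finset (Fin n)))
    (f := fun T => ∏ j ∈ T, (C (σ j z) : R⟦X⟧) * X ^ w)
  rw [Finset.card_univ, Fintype.card_fin] at h2
  change ∏ j, map (σ j) _ = _
  simp only [map_add, map_one, map_mul, map_C, map_pow, map_X]
  rw [h, h2]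
  refine Finset.sum_congr rfl fun k _ => ?_
  rw [esum, map_sum, Finset.sum_mul]
  refine Finset.sum_congr rfl fun T hT => ?_
  rw [Finset.prod_mul_distrib, Finset.prod_const, (Finset.mem_powersetCard.1 hT).2, map_prod,
    pow_mul]

theorem esum_eq_zero (σ : Fin n → B →+* R) {k : ℕ} (hk : n < k) (z : B) : esum σ k z = 0 := by
  rw [esum, Finset.powersetCard_eq_empty.2 (by simpa using hk), Finset.sum_empty]

theorem coeff_normSeries_one_add_pow (σ : Fin n → B →+* R) (z : B) (w k : ℕ) :
    coeff k (normSeries σ (1 + C z * X ^ (w + 1))) =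
      if w + 1 ∣ k then esum σ (k / (w + 1)) z else 0 := by
  rw [normSeries_one_add, map_sum]
  simp only [coeff_C_mul, coeff_X_pow, mul_ite, mul_one, mul_zero]
  split_ifs with h
  · obtain ⟨l, rfl⟩ := h
    rw [Nat.mul_div_cancel_left _ (Nat.succ_pos w)]
    have : ∀ x, (w + 1) * l = (w + 1) * x ↔ l = x := fun x => by simp
    simp only [this, Finset.sum_ite_eq, Finset.mem_range]
    split_ifs with h2
    · rfl
    · exact (esum_eq_zero σ (by omega) z).symm
  · refine Finset.sum_eq_zero fun x _ => if_neg ?_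
    rintro rfl
    exact h (dvd_mul_right _ _)

theorem coeff_normSeries_one_add (σ : Fin n → B →+* R) (z : B) (k : ℕ) :
    coeff k (normSeries σ (1 + C z * X)) = esum σ k z := by
  have := coeff_normSeries_one_add_pow σ z 0 k
  simpa using this

/-- Norms are `t`-adically continuous; this makes `normSubmonoid` closed. -/
theorem normSeries_sub_dvd (σ : Fin n → B →+* R) {f g : B⟦X⟧} {d : ℕ} (h : X ^ d ∣ f - g) :
    X ^ d ∣ normSeries σ f - normSeries σ g := by
  rw [← Ideal.mem_span_singleton, ← Ideal.Quotient.eq]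
  change Ideal.Quotient.mk _ (∏ j, map (σ j) f) = Ideal.Quotient.mk _ (∏ j, map (σ j) g)
  rw [map_prod, map_prod]
  refine Finset.prod_congr rfl fun j _ => ?_
  rw [Ideal.Quotient.eq, Ideal.mem_span_singleton, ← map_sub]
  simpa using map_dvd (map (σ j)) h

theorem constantCoeff_normSeries (σ : Fin n → B →+* R) {f : B⟦X⟧} (h : constantCoeff f = 1) :
    constantCoeff (normSeries σ f) = 1 := by
  have h1 : X ^ 1 ∣ f - 1 := by rw [pow_one, X_dvd_iff, map_sub, h, map_one, sub_self]
  have h2 := normSeries_sub_dvd σ h1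
  rw [pow_one, map_one, X_dvd_iff, map_sub, map_one, sub_eq_zero] at h2
  exact h2

/-- The power series with constant coefficient `1` all of whose norms have their other
coefficients in `T`. -/
def normSubmonoid {ι : Type*} {N : ι → ℕ} {R : ι → Type*} [∀ i, CommRing (R i)]
    (σ : ∀ i, Fin (N i) → B →+* R i) (T : NonUnitalSubring (∀ i, R i)) : Submonoid B⟦X⟧ where
  carrier := {f | constantCoeff f = 1 ∧
    ∀ k ≠ 0, (fun i => coeff k (normSeries (σ i) f)) ∈ T}
  one_mem' := ⟨map_one _, fun k hk => by
    simp only [map_one, coeff_one, hk, if_false]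
    exact T.zero_mem⟩
  mul_mem' := by
    rintro f g ⟨hf, hf'⟩ ⟨hg, hg'⟩
    refine ⟨by rw [map_mul, hf, hg, mul_one], fun k hk => ?_⟩
    have : (fun i => coeff k (normSeries (σ i) (f * g))) =
        ∑ p ∈ Finset.HasAntidiagonal.antidiagonal k, fun i =>
          coeff p.1 (normSeries (σ i) f) * coeff p.2 (normSeries (σ i) g) := by
      funext i
      rw [map_mul, coeff_mul, Finset.sum_apply]
    rw [this]
    refine sum_mem fun p hp => ?_
    have hp' := Finset.HasAntidiagonal.mem_antidiagonal.1 hp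
    -- The two extreme terms of the convolution contain the factor 1, which need not lie in the
    -- non-unital ring `T`, so they are treated separately.
    by_cases h1 : p.1 = 0
    · have h2 : p.2 ≠ 0 := by omega
      convert hg' p.2 h2 using 2 with i
      rw [h1, coeff_zero_eq_constantCoeff_apply, constantCoeff_normSeries _ hf, one_mul]
    · by_cases h2 : p.2 = 0
      · convert hf' p.1 h1 using 2 with i
        rw [h2, coeff_zero_eq_constantCoeff_apply, constantCoeff_normSeries _ hg, mul_one]
      · exact T.mul_mem (hf' p.1 h1) (hg' p.2 h2)

/-- If the elementary symmetric functions of the elements of an additive generating set of an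
ideal `V` lie in `T`, then so do the coefficients of the norms of the elements of
`1 + t V⟦t⟧`. -/
theorem coeff_normSeries_mem {ι : Type*} {N : ι → ℕ} {R : ι → Type*} [∀ i, CommRing (R i)]
    (σ : ∀ i, Fin (N i) → B →+* R i) (T : NonUnitalSubring (∀ i, R i)) (V : Ideal B)
    (G : Set B) (hGV : G ⊆ V) (hVG : (V : Set B) ⊆ AddSubmonoid.closure G)
    (hG : ∀ g ∈ G, ∀ k ≠ 0, (fun i => esum (σ i) k g) ∈ T)
    (f : B⟦X⟧) (h0 : constantCoeff f = 1) (hf : map (Ideal.Quotient.mk V) f = 1)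
    (k : ℕ) (hk : k ≠ 0) : (fun i => coeff k (normSeries (σ i) f)) ∈ T := by
  refine (mem_of_one_add_mem (normSubmonoid σ T) V G hGV hVG ?_ ?_ f h0 hf).2 k hk
  · intro f hf
    refine ⟨?_, fun k hk => ?_⟩
    · obtain ⟨g, hg, hd⟩ := hf 1
      rw [pow_one, X_dvd_iff, map_sub, hg.1, sub_eq_zero] at hd
      exact hd
    · obtain ⟨g, hg, hd⟩ := hf (k + 1)
      convert hg.2 k hk using 2 with i
      have := X_pow_dvd_iff.1 (normSeries_sub_dvd (σ i) hd) k (Nat.lt_succ_self k)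
      rwa [map_sub, sub_eq_zero] at this
  · intro g hg w
    refine ⟨by simp, fun k hk => ?_⟩
    simp only [coeff_normSeries_one_add_pow]
    split_ifs with h
    · exact hG g hg _ (Nat.div_pos (Nat.le_of_dvd (Nat.pos_of_ne_zero hk) h) (Nat.succ_pos w)).ne'
    · exact T.zero_mem

theorem esum_mem {ι : Type*} {N : ι → ℕ} {R : ι → Type*} [∀ i, CommRing (R i)]
    (σ : ∀ i, Fin (N i) → B →+* R i) (T : NonUnitalSubring (∀ i, R i)) (V : Ideal B)
    (G : Set B) (hGV : G ⊆ V) (hVG : (V : Set B) ⊆ AddSubmonoid.closure G)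
    (hG : ∀ g ∈ G, ∀ k ≠ 0, (fun i => esum (σ i) k g) ∈ T)
    {z : B} (hz : z ∈ V) {k : ℕ} (hk : k ≠ 0) : (fun i => esum (σ i) k z) ∈ T := by
  have := coeff_normSeries_mem σ T V G hGV hVG hG (1 + C z * X) (by simp)
    (by simp [Ideal.Quotient.eq_zero_iff_mem.2 hz]) k hk
  simpa only [coeff_normSeries_one_add] using this

end PowerSeries

/-! ### Insertions and elementary symmetric functions after base change. -/

section BaseChange

variable (F : Type u) [CommRing F] (n : ℕ) {A : Type v} [CommRing A] [Algebra F A]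
  (L : Type w) [CommRing L] [Algebra F L]

/-- The base change of the `j`-th insertion `A → A ⊗ ⋯ ⊗ A`. -/
def insL (j : Fin n) : L ⊗[F] A →+* L ⊗[F] TPow F n A :=
  (Algebra.TensorProduct.map (AlgHom.id F L) (ins F n j)).toRingHom

theorem insL_tmul (j : Fin n) (c : L) (a : A) : insL F n L j (c ⊗ₜ a) = c ⊗ₜ ins F n j a := rfl

theorem baseChange_ins (j : Fin n) (z : L ⊗[F] A) :
    (ins F n j).toLinearMap.baseChange L z = insL F n L j z := by
  induction z with
  | zero => rw [map_zero, map_zero]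
  | tmul c a => rfl
  | add x y hx hy => rw [map_add, map_add, hx, hy]

theorem coe_elemSym (k : ℕ) (a : A) :
    (elemSym F n k a : TPow F n A) = esum (fun j => (ins F n j : A →ₐ[F] TPow F n A).toRingHom) k a := by
  simp [elemSym, esum, MvPolynomial.esymm]

theorem esum_insL_tmul (k : ℕ) (c : L) (a : A) :
    esum (insL F n L) k (c ⊗ₜ[F] a) = (c ^ k) ⊗ₜ (elemSym F n k a : TPow F n A) := by
  rw [coe_elemSym, esum, esum, TensorProduct.tmul_sum]
  refine Finset.sum_congr rfl fun T hT => ?_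
  have := map_prod (Algebra.TensorProduct.includeRight : TPow F n A →ₐ[F] L ⊗[F] TPow F n A)
    (fun j => ins F n j a) T
  have h2 : ∀ j, insL F n L j (c ⊗ₜ[F] a) = (c ⊗ₜ[F] (1 : TPow F n A)) *
      (Algebra.TensorProduct.includeRight : TPow F n A →ₐ[F] L ⊗[F] TPow F n A)
        (ins F n j a) := fun j => by
    rw [Algebra.TensorProduct.includeRight_apply, Algebra.TensorProduct.tmul_mul_tmul, mul_one,
      one_mul, insL_tmul]
  simp only [h2, Finset.prod_mul_distrib, Finset.prod_const, (Finset.mem_powersetCard.1 hT).2,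
    ← this]
  rw [Algebra.TensorProduct.includeRight_apply, Algebra.TensorProduct.tmul_pow, one_pow,
    Algebra.TensorProduct.tmul_mul_tmul, mul_one, one_mul]
  rfl

theorem elemLaw_apply (L : Type u) [CommRing L] [Algebra F L] (k : ℕ) (z : L ⊗[F] A) :
    (elemLaw F n k).toFun' L z = esum (insL F n L) k z := by
  simp only [elemLaw, esum, MvPolynomial.esymm, map_sum, map_prod, MvPolynomial.aeval_X]
  rfl

theorem tprod_eq_prod_ins (a : Fin n → A) :
    PiTensorProduct.tprod F a = ∏ j, ins F n j (a j) := by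
  simp only [PiTensorProduct.singleAlgHom_apply]
  rw [← PiTensorProduct.tprodMonoidHom_apply]
  simp only [← PiTensorProduct.tprodMonoidHom_apply, ← map_prod]
  congr 1
  exact (Finset.univ_prod_mulSingle a).symm

theorem prod_insL_tprod (c : Fin n → L) (a : Fin n → A) :
    ∏ j, insL F n L j (c j ⊗ₜ[F] a j) = (∏ j, c j) ⊗ₜ PiTensorProduct.tprod F a := by
  simp only [insL_tmul]
  rw [tprod_eq_prod_ins]
  induction (Finset.univ : Finset (Fin n)) using Finset.induction_on with
  | empty => simp [Algebra.TensorProduct.one_def]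
  | insert j s hj ih =>
    rw [Finset.prod_insert hj, Finset.prod_insert hj, Finset.prod_insert hj, ih,
      Algebra.TensorProduct.tmul_mul_tmul]

/-- The extension of scalars of a linear form. -/
def extForm {M : Type*} [AddCommMonoid M] [Module F M] (ψ : M →ₗ[F] F) : L ⊗[F] M →ₗ[L] L :=
  (TensorProduct.AlgebraTensorModule.rid F L L).toLinearMap ∘ₗ ψ.baseChange L

theorem extForm_tmul {M : Type*} [AddCommMonoid M] [Module F M] (ψ : M →ₗ[F] F) (c : L) (x : M) :
    extForm F L ψ (c ⊗ₜ x) = ψ x • c := by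
  simp [extForm]

/-- A coefficient in `L` and a coordinate in `M` can be extracted in either order. This transfers
computations over `F[t]` to coefficients of laws. -/
theorem apply_extForm {M : Type*} [AddCommMonoid M] [Module F M] (ψ : M →ₗ[F] F) (l : L →ₗ[F] F)
    (x : L ⊗[F] M) : l (extForm F L ψ x) = ψ (TensorProduct.lid F M (l.rTensor M x)) := by
  induction x with
  | zero => simp
  | tmul c x => simp [extForm_tmul, mul_comm]
  | add x y hx hy => simp [hx, hy]

/-- A multiplicativity property of a linear form can be checked on a basis. -/
theorem apply_prod_of_basis {n : ℕ} {L : Type*} [CommRing L] {κ M R : Type*} [AddCommGroup M]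
    [Module L M] [CommRing R] [Algebra L R] (b : Module.Basis κ L M) (g : Fin n → M →ₗ[L] R)
    (ψ : R →ₗ[L] L) (h : Fin n → M →ₗ[L] L)
    (H : ∀ v : Fin n → κ, ψ (∏ j, g j (b (v j))) = ∏ j, h j (b (v j))) (z : Fin n → M) :
    ψ (∏ j, g j (z j)) = ∏ j, h j (z j) := by
  have key : ψ.compMultilinearMap ((MultilinearMap.mkPiAlgebra L (Fin n) R).compLinearMap g) =
      (MultilinearMap.mkPiAlgebra L (Fin n) L).compLinearMap h :=
    Module.Basis.ext_multilinear (fun _ => b) fun v => by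
      simpa only [LinearMap.compMultilinearMap_apply, MultilinearMap.compLinearMap_apply,
        MultilinearMap.mkPiAlgebra_apply] using H v
  simpa only [LinearMap.compMultilinearMap_apply, MultilinearMap.compLinearMap_apply,
    MultilinearMap.mkPiAlgebra_apply] using DFunLike.congr_fun key z

theorem extForm_coord_prod {κ : Type*} (b : Module.Basis κ F A) (f : Fin n → κ)
    (z : Fin n → L ⊗[F] A) :
    extForm F L ((Basis.piTensorProduct fun _ => b).coord f) (∏ j, insL F n L j (z j)) =
      ∏ j, extForm F L (b.coord (f j)) (z j) := by
  have h := apply_prod_of_basis (Algebra.TensorProduct.basis L b)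
    (fun j => (ins F n j).toLinearMap.baseChange L)
    (extForm F L ((Basis.piTensorProduct fun _ => b).coord f))
    (fun j => extForm F L (b.coord (f j))) (fun v => by
      have h1 := prod_insL_tprod F n L (fun _ => (1 : L)) (fun j => b (v j))
      simp only [Algebra.TensorProduct.basis_apply, baseChange_ins]
      rw [h1, extForm_tmul]
      simp only [extForm_tmul, Finset.prod_const_one, Module.Basis.coord_apply,
        Basis.piTensorProduct_repr_tprod_apply, ← Algebra.algebraMap_eq_smul_one, map_prod]) z
  simpa only [baseChange_ins] using h

end BaseChange

/-! ### Coordinates of tensors of polynomials with respect to tensors of monomials. -/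

section Coordinates

variable (F : Type u) [CommRing F] {Ω : Type v} {n : ℕ} (L : Type w) [CommRing L] [Algebra F L]

/-- The coefficient of a tensor product of monomials. -/
def tcoeff (f : Fin n → Ω →₀ ℕ) : TPow F n (MvPolynomial Ω F) →ₗ[F] F :=
  (Basis.piTensorProduct fun _ => MvPolynomial.basisMonomials Ω F).coord f

theorem tcoeff_tprod (f : Fin n → Ω →₀ ℕ) (p : Fin n → MvPolynomial Ω F) :
    tcoeff F f (PiTensorProduct.tprod F p) = ∏ j, (p j).coeff (f j) := by
  simp only [tcoeff, Module.Basis.coord_apply, Basis.piTensorProduct_repr_tprod_apply]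
  rfl

theorem tpow_ext {x y : TPow F n (MvPolynomial Ω F)}
    (h : ∀ f : Fin n → Ω →₀ ℕ, tcoeff F f x = tcoeff F f y) : x = y :=
  (Basis.piTensorProduct fun _ => MvPolynomial.basisMonomials Ω F).ext_elem h

theorem finite_support_tcoeff (x : TPow F n (MvPolynomial Ω F)) :
    {f : Fin n → Ω →₀ ℕ | tcoeff F f x ≠ 0}.Finite :=
  ((Basis.piTensorProduct fun _ => MvPolynomial.basisMonomials Ω F).repr x).hasFiniteSupport

theorem extForm_prod (f : Fin n → Ω →₀ ℕ) (z : Fin n → L ⊗[F] MvPolynomial Ω F) :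
    extForm F L (tcoeff F f) (∏ j, insL F n L j (z j)) =
      ∏ j, extForm F L (MvPolynomial.lcoeff F (f j)) (z j) :=
  extForm_coord_prod F n L (MvPolynomial.basisMonomials Ω F) f z

theorem prod_subset_eq (T : Finset (Fin n)) {B : Type*} [CommRing B] {R : Type*} [CommRing R]
    (σ : Fin n → B →+* R) (z : B) :
    ∏ j ∈ T, σ j z = ∏ j, σ j (if j ∈ T then z else 1) := by
  simp only [apply_ite (σ _), map_one, Finset.prod_ite_mem, Finset.univ_inter]

-- In the sum over subsets `T`, only the set of slots with `f j ≠ 0` contributes: a slot of `T` with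
-- `f j = 0` yields the constant term of `z`, and a slot outside `T` with `f j ≠ 0` yields a
-- nonconstant coefficient of 1.
open scoped Classical in
theorem extForm_esum (f : Fin n → Ω →₀ ℕ) (k : ℕ) (z : L ⊗[F] MvPolynomial Ω F)
    (hz : extForm F L (MvPolynomial.lcoeff F 0) z = 0) :
    extForm F L (tcoeff F f) (esum (insL F n L) k z) =
      if (Finset.univ.filter fun j => f j ≠ 0).card = k then
        ∏ j ∈ Finset.univ.filter (fun j => f j ≠ 0), extForm F L (MvPolynomial.lcoeff F (f j)) z
      else 0 := by
  classical
  rw [esum, map_sum]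
  simp only [prod_subset_eq, extForm_prod]
  have h1 : ∀ μ : Ω →₀ ℕ, extForm F L (MvPolynomial.lcoeff F μ) 1 = if μ = 0 then 1 else 0 := by
    intro μ
    rw [Algebra.TensorProduct.one_def, extForm_tmul]
    simp [MvPolynomial.coeff_one, eq_comm]
  have h2 : ∀ T : Finset (Fin n), T ≠ Finset.univ.filter (fun j => f j ≠ 0) →
      ∏ j, extForm F L (MvPolynomial.lcoeff F (f j)) (if j ∈ T then z else 1) = 0 := by
    intro T hT
    by_contra h3
    refine hT (Finset.ext fun j => ?_)
    simp only [Finset.mem_filter, Finset.mem_univ, true_and]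
    constructor
    · intro hj hf
      refine h3 (Finset.prod_eq_zero (Finset.mem_univ j) ?_)
      rw [if_pos hj, hf, hz]
    · intro hj
      by_contra hT
      refine h3 (Finset.prod_eq_zero (Finset.mem_univ j) ?_)
      rw [if_neg hT, h1, if_neg hj]
  split_ifs with hk
  · rw [Finset.sum_eq_single (Finset.univ.filter fun j => f j ≠ 0) (fun T _ hT => h2 T hT)
      (fun h => absurd (Finset.mem_powersetCard.2 ⟨Finset.subset_univ _, hk⟩) h)]
    rw [Finset.prod_filter]
    refine Finset.prod_congr rfl fun j _ => ?_
    simp only [Finset.mem_filter, Finset.mem_univ, true_and]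
    split_ifs with hj
    · rfl
    · rw [h1, if_pos (not_not.1 hj)]
  · refine Finset.sum_eq_zero fun T hT => h2 T ?_
    rintro rfl
    exact hk (Finset.mem_powersetCard.1 hT).2

theorem esum_self {B : Type*} [CommRing B] {R : Type*} [CommRing R]
    (σ : Fin n → B →+* R) (z : B) : esum σ n z = ∏ j, σ j z := by
  have : Finset.powersetCard n (Finset.univ : Finset (Fin n)) = {Finset.univ} := by
    simpa using Finset.powersetCard_self (Finset.univ : Finset (Fin n))
  rw [esum, this, Finset.sum_singleton]

theorem extForm_esum_self (f : Fin n → Ω →₀ ℕ) (z : L ⊗[F] MvPolynomial Ω F) :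
    extForm F L (tcoeff F f) (esum (insL F n L) n z) =
      ∏ j, extForm F L (MvPolynomial.lcoeff F (f j)) z := by
  rw [esum_self, extForm_prod F L f fun _ => z]

end Coordinates

/-! ### Nontrivial monomials as unique powers of primitive ones. -/

section PrimitivePowers

variable {Ω : Type v}

/-- The monomial `μ ^ k`. -/
def primPow (p : ℕ+ × PrimMon Ω) : Ω →₀ ℕ := (p.1 : ℕ) • p.2.1

theorem gcd_primPow (p : ℕ+ × PrimMon Ω) : (primPow p).support.gcd (primPow p) = p.1 := by
  have h1 : (primPow p).support = p.2.1.support :=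
    Finsupp.support_smul_eq p.1.ne_zero
  have h2 : ⇑(primPow p) = fun x => (p.1 : ℕ) * p.2.1 x := by
    funext x; simp [primPow]
  rw [h1, h2, Finset.gcd_mul_left, p.2.2]
  simp

theorem primPow_injective : Function.Injective (primPow : ℕ+ × PrimMon Ω → Ω →₀ ℕ) := by
  intro p q h
  have h1 : p.1 = q.1 := by
    have := gcd_primPow p
    rw [h, gcd_primPow q] at this
    exact PNat.coe_injective this.symm
  refine Prod.ext h1 (Subtype.ext (Finsupp.ext fun x => ?_))
  have := DFunLike.congr_fun h x
  simp only [primPow, h1, Finsupp.smul_apply, smul_eq_mul] at this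
  exact Nat.eq_of_mul_eq_mul_left q.1.pos this

theorem primPow_ne_zero (p : ℕ+ × PrimMon Ω) : primPow p ≠ 0 := by
  intro h
  have := gcd_primPow p
  rw [h] at this
  simp at this
  exact p.1.ne_zero this.symm

theorem exists_primPow {μ : Ω →₀ ℕ} (hμ : μ ≠ 0) : ∃ p : ℕ+ × PrimMon Ω, primPow p = μ := by
  set k := μ.support.gcd μ with hk
  have hk0 : k ≠ 0 := by
    intro h
    rw [hk, Finset.gcd_eq_zero_iff] at h
    obtain ⟨x, hx⟩ := Finsupp.support_nonempty_iff.2 hμ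
    exact (Finsupp.mem_support_iff.1 hx) (h x hx)
  have hdvd : ∀ x, k ∣ μ x := fun x => by
    by_cases hx : x ∈ μ.support
    · exact Finset.gcd_dvd hx
    · rw [Finsupp.notMem_support_iff.1 hx]; exact dvd_zero k
  let ν : Ω →₀ ℕ := μ.mapRange (· / k) (Nat.zero_div k)
  have hν : k • ν = μ := Finsupp.ext fun x => by
    simp only [ν, Finsupp.smul_apply, smul_eq_mul, Finsupp.mapRange_apply]
    exact Nat.mul_div_cancel' (hdvd x)
  have hs : μ.support = ν.support := by
    rw [← Finsupp.support_smul_eq hk0 (g := ν), hν]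
  have hf : ⇑μ = fun x => k * ν x := by
    funext x; rw [← hν]; rfl
  have h1 : k * ν.support.gcd ν = k := by
    conv_rhs => rw [hk, hs, hf, Finset.gcd_mul_left]
    simp
  exact ⟨(⟨k, Nat.pos_of_ne_zero hk0⟩, ⟨ν, by simpa [hk0] using h1⟩), hν⟩

end PrimitivePowers

/-! ### Factorization of `1 - X ^ k` by roots of unity. -/

/-- There is a ring containing the `k`-th roots of unity, in which `ℤ` is a direct summand as an
abelian group. -/
theorem exists_root_factorization (k : ℕ) (hk : k ≠ 0) :
    ∃ (Z : Type) (_ : CommRing Z) (W : Finset Z) (l : Z →ₗ[ℤ] ℤ), l 1 = 1 ∧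
      ∏ w ∈ W, (1 - Polynomial.C w * Polynomial.X) = 1 - Polynomial.X ^ k := by
  obtain ⟨ζ, hζ⟩ : ∃ ζ : ℂ, IsPrimitiveRoot ζ k := ⟨_, Complex.isPrimitiveRoot_exp k hk⟩
  have hint : IsIntegral ℤ ζ := hζ.isIntegral (Nat.pos_of_ne_zero hk)
  let pb := Algebra.adjoin.powerBasis' hint
  -- The power basis of `ℤ[ζ]` begins with 1, so its zeroth coordinate is a retraction onto `ℤ`.
  have hd : 0 < pb.dim := pb.dim_pos
  refine ⟨Algebra.adjoin ℤ {ζ}, inferInstance,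
    Polynomial.nthRootsFinset k (1 : Algebra.adjoin ℤ {ζ}), pb.basis.coord ⟨0, hd⟩, ?_, ?_⟩
  · have : pb.basis ⟨0, hd⟩ = 1 := by rw [pb.basis_eq_pow]; simp
    have h := pb.basis.repr_self ⟨0, hd⟩
    rw [this] at h
    rw [Module.Basis.coord_apply, h, Finsupp.single_eq_same]
  · have hz : IsPrimitiveRoot (⟨ζ, Algebra.self_mem_adjoin_singleton ℤ ζ⟩ :
        Algebra.adjoin ℤ {ζ}) k :=
      IsPrimitiveRoot.of_map_of_injective (f := (Algebra.adjoin ℤ {ζ}).val) hζ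
        Subtype.val_injective
    refine Polynomial.funext fun y => ?_
    have := hz.pow_sub_pow_eq_prod_sub_mul (x := 1) (y := y) (Nat.pos_of_ne_zero hk)
    simpa [Polynomial.eval_prod] using this.symm

theorem prod_one_add_of_factorization {Z B : Type*} [CommRing Z] [CommRing B] {W : Finset Z}
    {k : ℕ} (hW : ∏ w ∈ W, (1 - Polynomial.C w * Polynomial.X) = 1 - Polynomial.X ^ k)
    (φ : Z →+* B) (x : B) :
    ∏ w ∈ W, (1 + PowerSeries.C (-(φ w * x)) * PowerSeries.X) =
      1 + PowerSeries.C (-x ^ k) * PowerSeries.X ^ k := by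
  have := congrArg (Polynomial.eval₂RingHom ((PowerSeries.C : B →+* PowerSeries B).comp φ)
    (PowerSeries.C x * PowerSeries.X)) hW
  simp only [map_prod, map_sub, map_one, map_mul, map_pow, Polynomial.coe_eval₂RingHom,
    Polynomial.eval₂_C, Polynomial.eval₂_X, RingHom.comp_apply] at this
  simpa only [map_neg, map_mul, map_pow, neg_mul, ← sub_eq_add_neg, mul_pow, mul_assoc]
    using this

theorem coeff_normSeries_mul {B R : Type*} [CommRing B] [CommRing R] {n : ℕ}
    (σ : Fin n → B →+* R) (z : B) {k : ℕ} (hk : k ≠ 0) (i : ℕ) :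
    PowerSeries.coeff (k * i) (normSeries σ (1 + PowerSeries.C z * PowerSeries.X ^ k)) =
      esum σ i z := by
  obtain ⟨k, rfl⟩ := Nat.exists_eq_succ_of_ne_zero hk
  rw [Nat.succ_eq_add_one, coeff_normSeries_one_add_pow, if_pos (dvd_mul_right _ _),
    Nat.mul_div_cancel_left _ (Nat.succ_pos k)]

/-! ### Stable expressions for the elementary symmetric functions of monomials. -/

section Power

variable (F : Type u) [CommRing F] (Ω : Type v)

/-- `κ_n` with values in the tensor power. -/
def kappaT (n : ℕ) : ERing F Ω →ₐ[F] TPow F n (MvPolynomial Ω F) :=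
  (TS F n (MvPolynomial Ω F)).val.comp (kappa F Ω n)

/-- The base change of `κ_n`. -/
def kappaL (L : Type w) [CommRing L] [Algebra F L] (n : ℕ) :
    L ⊗[F] ERing F Ω →+* L ⊗[F] TPow F n (MvPolynomial Ω F) :=
  (Algebra.TensorProduct.map (AlgHom.id F L) (kappaT F Ω n)).toRingHom

theorem kappaL_tmul (L : Type w) [CommRing L] [Algebra F L] (n : ℕ) (c : L) (y : ERing F Ω) :
    kappaL F Ω L n (c ⊗ₜ y) = c ⊗ₜ kappaT F Ω n y := rfl

theorem kappaL_eq_lTensor (L : Type w) [CommRing L] [Algebra F L] (n : ℕ)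
    (y : L ⊗[F] ERing F Ω) :
    kappaL F Ω L n y = (kappaT F Ω n).toLinearMap.lTensor L y := by
  induction y with
  | zero => rw [map_zero, map_zero]
  | tmul c a => rfl
  | add x y hx hy => rw [map_add, map_add, hx, hy]

/-- The families of elements of the tensor powers which are stably expressed by an element of
`L ⊗ E`. -/
def stableRange (L : Type w) [CommRing L] [Algebra F L] :
    Subring (∀ n, L ⊗[F] TPow F n (MvPolynomial Ω F)) :=
  (RingHom.pi fun n => kappaL F Ω L n).range

theorem mem_stableRange (L : Type w) [CommRing L] [Algebra F L]
    (x : ∀ n, L ⊗[F] TPow F n (MvPolynomial Ω F)) :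
    x ∈ stableRange F Ω L ↔ ∃ y, ∀ n, kappaL F Ω L n y = x n := by
  simp only [stableRange, RingHom.mem_range, funext_iff]
  rfl

/-- The case distinction in `kappa` disappears because `e_i` in `n` variables vanishes for `i > n`.
-/
theorem kappaT_X (p : ℕ+ × PrimMon Ω) (n : ℕ) :
    kappaT F Ω n (MvPolynomial.X p) =
      (elemSym F n p.1 (MvPolynomial.monomial p.2.1 (1 : F)) :
        TPow F n (MvPolynomial Ω F)) := by
  simp only [kappaT, kappa, AlgHom.comp_apply, MvPolynomial.aeval_X]
  split_ifs with h
  · rfl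
  · rw [coe_elemSym, esum_eq_zero _ (not_le.1 h)]
    simp

theorem lid_rTensor_lTensor {L M M' : Type*} [AddCommMonoid L] [Module F L] [AddCommMonoid M]
    [Module F M] [AddCommMonoid M'] [Module F M'] (l : L →ₗ[F] F) (g : M →ₗ[F] M')
    (x : L ⊗[F] M) :
    TensorProduct.lid F M' (l.rTensor M' (g.lTensor L x)) =
      g (TensorProduct.lid F M (l.rTensor M x)) := by
  induction x with
  | zero => simp
  | tmul c x => simp
  | add x y hx hy => simp [hx, hy]

/-- Each factor `1 - wνt` of `1 - ν^k t^k` has norm coefficients `(-w)^j e_j(ν)`, images of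
multiples of variables. By multiplicativity the norm coefficient of the product at `t^(ki)`, which
is `(-1)^i e_i(ν^k)`, is stably expressible. -/
theorem elemSym_pow_mem_stableRange {L : Type w} [CommRing L] [Algebra F L] {Z : Type*}
    [CommRing Z] {W : Finset Z} {k : ℕ} (hk : k ≠ 0)
    (hW : ∏ w ∈ W, (1 - Polynomial.C w * Polynomial.X) = 1 - Polynomial.X ^ k)
    (φ : Z →+* L) (ν : PrimMon Ω) {i : ℕ} (hi : i ≠ 0) :
    (fun n => ((-1 : L) ^ i) ⊗ₜ[F] (elemSym F n i (MvPolynomial.monomial ν.1 (1 : F) ^ k) :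
      TPow F n (MvPolynomial Ω F))) ∈ stableRange F Ω L := by
  set mν : MvPolynomial Ω F := MvPolynomial.monomial ν.1 1
  have hfac := prod_one_add_of_factorization hW
      ((Algebra.TensorProduct.includeLeftRingHom : L →+* L ⊗[F] MvPolynomial Ω F).comp φ)
      ((1 : L) ⊗ₜ[F] mν)
  have e1 : -((1 : L) ⊗ₜ[F] mν) ^ k = (-1 : L) ⊗ₜ[F] (mν ^ k) := by
    rw [Algebra.TensorProduct.tmul_pow, one_pow, TensorProduct.neg_tmul]
  have e2 : ∀ w, -((Algebra.TensorProduct.includeLeftRingHom :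
      L →+* L ⊗[F] MvPolynomial Ω F).comp φ w * ((1 : L) ⊗ₜ[F] mν)) = (-φ w) ⊗ₜ[F] mν := by
    intro w
    rw [RingHom.comp_apply, Algebra.TensorProduct.includeLeftRingHom_apply,
      Algebra.TensorProduct.tmul_mul_tmul, mul_one, one_mul, TensorProduct.neg_tmul]
  simp only [e1, e2] at hfac
  have hmem : 1 + PowerSeries.C ((-1 : L) ⊗ₜ[F] (mν ^ k)) * PowerSeries.X ^ k ∈
      normSubmonoid (fun n => insL F n L (A := MvPolynomial Ω F))
        (stableRange F Ω L).toNonUnitalSubring := by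
    rw [← hfac]
    refine prod_mem fun w _ => ⟨by simp, fun j hj => ?_⟩
    simp only [coeff_normSeries_one_add, esum_insL_tmul]
    refine (mem_stableRange F Ω L _).2 ⟨((-φ w) ^ j) ⊗ₜ
      MvPolynomial.X (⟨j, Nat.pos_of_ne_zero hj⟩, ν), fun n => ?_⟩
    rw [kappaL_tmul, kappaT_X]
    rfl
  have h2 := hmem.2 (k * i) (Nat.mul_ne_zero hk hi)
  simp only [coeff_normSeries_mul _ _ hk, esum_insL_tmul] at h2
  exact h2

theorem exists_kappaT_eq_of_mem_stableRange {L : Type w} [CommRing L] [Algebra F L]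
    (l : L →ₗ[F] F) (hl : l 1 = 1) (c : F) {x : ∀ n, TPow F n (MvPolynomial Ω F)}
    (hx : (fun n => (algebraMap F L c) ⊗ₜ[F] x n) ∈ stableRange F Ω L) :
    ∃ y : ERing F Ω, ∀ n, kappaT F Ω n y = c • x n := by
  obtain ⟨y, hy⟩ := (mem_stableRange F Ω L _).1 hx
  refine ⟨TensorProduct.lid F _ (l.rTensor _ y), fun n => ?_⟩
  have h4 := congrArg (fun t => TensorProduct.lid F _ (l.rTensor _ t)) (hy n)
  simp only [kappaL_eq_lTensor, lid_rTensor_lTensor] at h4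
  rw [LinearMap.rTensor_tmul, TensorProduct.lid_tmul, Algebra.algebraMap_eq_smul_one, map_smul,
    hl, smul_eq_mul, mul_one] at h4
  exact h4

/-- The elements `e_i(μ)` are stably polynomials in the `e_j(ν)` with `ν` primitive. -/
theorem exists_kappaT_eq_elemSym (i : ℕ) {μ : Ω →₀ ℕ} (hμ : μ ≠ 0) :
    ∃ y : ERing F Ω, ∀ n, kappaT F Ω n y =
      (elemSym F n i (MvPolynomial.monomial μ (1 : F)) : TPow F n (MvPolynomial Ω F)) := by
  obtain ⟨⟨k, ν⟩, rfl⟩ := exists_primPow hμ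
  -- The monoid argument controls only coefficients of positive degree; `e_0 = 1` is separate.
  by_cases hi : i = 0
  · subst hi
    refine ⟨1, fun n => ?_⟩
    rw [coe_elemSym, map_one]
    simp [esum]
  obtain ⟨Z, _, W, l, hl, hW⟩ := exists_root_factorization k k.ne_zero
  have h := elemSym_pow_mem_stableRange F Ω k.ne_zero hW
    (Algebra.TensorProduct.includeRight : Z →ₐ[ℤ] F ⊗[ℤ] Z).toRingHom ν hi
  have e : ((-1 : F ⊗[ℤ] Z) ^ i) = algebraMap F (F ⊗[ℤ] Z) ((-1) ^ i) := by
    rw [map_pow, map_neg, map_one]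
  simp only [e] at h
  -- The retraction `Z → ℤ` extends to an `F`-linear retraction `F ⊗ Z → F`, which removes the roots
  -- of unity from the expression. The remaining sign is cancelled by `(-1)^i`.
  obtain ⟨y, hy⟩ := exists_kappaT_eq_of_mem_stableRange F Ω (extForm ℤ F l)
    (by rw [Algebra.TensorProduct.one_def, extForm_tmul, hl, one_smul]) _ h
  refine ⟨(-1 : F) ^ i • y, fun n => ?_⟩
  have h7 : (MvPolynomial.monomial ν.1 (1 : F)) ^ (k : ℕ) =
      MvPolynomial.monomial (primPow (k, ν)) 1 := by
    simp [MvPolynomial.monomial_pow, primPow]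
  rw [map_smul, hy, smul_smul, ← mul_pow, h7]
  simp

end Power

/-! ### Additive generators of extended ideals, and stable expressions on `L ⊗ P⁺`. -/

section Generators

variable {F : Type u} [CommRing F] {L : Type w} [CommRing L] [Algebra F L]

/-- The extension of an ideal of `A` to `L ⊗ A`. -/
def extIdeal (L : Type w) [CommRing L] [Algebra F L] {A : Type v} [CommRing A] [Algebra F A]
    (I : Ideal A) : Ideal (L ⊗[F] A) :=
  I.map (Algebra.TensorProduct.includeRight : A →ₐ[F] L ⊗[F] A)

variable {A : Type v} [CommRing A] [Algebra F A]

theorem tmul_mem_extIdeal {I : Ideal A} (c : L) {a : A} (ha : a ∈ I) :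
    c ⊗ₜ[F] a ∈ extIdeal L I := by
  have h : c ⊗ₜ[F] a = (c ⊗ₜ[F] (1 : A)) *
      (Algebra.TensorProduct.includeRight : A →ₐ[F] L ⊗[F] A) a := by
    rw [Algebra.TensorProduct.includeRight_apply, Algebra.TensorProduct.tmul_mul_tmul, mul_one,
      one_mul]
  rw [h]
  exact Ideal.mul_mem_left _ _ (Ideal.mem_map_of_mem _ ha)

/-- The closure principle needs additive generators rather than ideal generators; pure tensors with
second factor in `I` are already stable under multiplication by pure tensors. -/
theorem extIdeal_subset_closure (I : Ideal A) :
    ((extIdeal L I : Ideal (L ⊗[F] A)) : Set (L ⊗[F] A)) ⊆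
      (AddSubmonoid.closure {x : L ⊗[F] A | ∃ (c : L) (a : A), a ∈ I ∧ x = c ⊗ₜ[F] a} : Set (L ⊗[F] A)) := by
  intro x hx
  induction hx using Submodule.span_induction with
  | mem x hx =>
    obtain ⟨a, ha, rfl⟩ := hx
    exact AddSubmonoid.subset_closure ⟨1, a, ha, rfl⟩
  | zero => exact zero_mem _
  | add x y _ _ hx hy => exact add_mem hx hy
  | smul r x hm hx =>
    clear hm
    induction hx using AddSubmonoid.closure_induction with
    | zero => rw [smul_zero]; exact zero_mem _
    | add x y _ _ hx hy => rw [smul_add]; exact add_mem hx hy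
    | mem x hx =>
      obtain ⟨c, a, ha, rfl⟩ := hx
      induction r with
      | zero => rw [zero_smul]; exact zero_mem _
      | add x y hx hy => rw [add_smul]; exact add_mem hx hy
      | tmul d b =>
        rw [smul_eq_mul, Algebra.TensorProduct.tmul_mul_tmul]
        exact AddSubmonoid.subset_closure ⟨_, _, I.mul_mem_left _ ha, rfl⟩

theorem tmul_mem_closure_monomial {Ω : Type v} (S : Set (Ω →₀ ℕ)) (c : L) (p : MvPolynomial Ω F)
    (hp : ∀ μ ∈ p.support, μ ∈ S) :
    c ⊗ₜ[F] p ∈ AddSubmonoid.closure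
      {x | ∃ (c : L) (μ : Ω →₀ ℕ), μ ∈ S ∧ x = c ⊗ₜ[F] MvPolynomial.monomial μ (1 : F)} := by
  rw [p.as_sum, TensorProduct.tmul_sum]
  refine sum_mem fun μ hμ => AddSubmonoid.subset_closure ⟨p.coeff μ • c, μ, hp μ hμ, ?_⟩
  rw [TensorProduct.smul_tmul, MvPolynomial.smul_monomial, smul_eq_mul, mul_one]

theorem mem_augIdeal {Ω : Type v} (p : MvPolynomial Ω F) :
    p ∈ augIdeal F Ω ↔ p.coeff 0 = 0 := by
  rw [augIdeal, RingHom.mem_ker]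
  have := MvPolynomial.aeval_zero (S₁ := F) p
  rw [show (fun _ : Ω => (0 : F)) = 0 from rfl, this]
  simp [MvPolynomial.constantCoeff_eq]

theorem lTensor_augIncl_mem {Ω : Type v} (z : L ⊗[F] augIdeal F Ω) :
    (augIncl F Ω).lTensor L z ∈ extIdeal L (augIdeal F Ω) := by
  induction z with
  | zero => rw [map_zero]; exact zero_mem _
  | tmul c a => exact tmul_mem_extIdeal c a.2
  | add x y hx hy => rw [map_add]; exact add_mem hx hy

theorem extForm_augIncl {Ω : Type v} (z : L ⊗[F] augIdeal F Ω) :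
    extForm F L (MvPolynomial.lcoeff F 0) ((augIncl F Ω).lTensor L z) = 0 := by
  induction z with
  | zero => rw [map_zero, map_zero]
  | tmul c a =>
    rw [LinearMap.lTensor_tmul, extForm_tmul]
    have : MvPolynomial.lcoeff F 0 (augIncl F Ω a) = 0 := (mem_augIdeal _).1 a.2
    rw [this, zero_smul]
  | add x y hx hy => rw [map_add, map_add, hx, hy, add_zero]

theorem esum_zero {B R : Type*} [CommRing B] [CommRing R] {n : ℕ} (σ : Fin n → B →+* R) (z : B) :
    esum σ 0 z = 1 := by
  simp [esum]

/-- The elementary symmetric functions of the elements of `L ⊗ P⁺` are stably expressed by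
elements of `L ⊗ E`. -/
theorem exists_kappaL_eq {Ω : Type v} (k : ℕ) (z : L ⊗[F] augIdeal F Ω) :
    ∃ y, ∀ n, kappaL F Ω L n y = esum (insL F n L) k ((augIncl F Ω).lTensor L z) := by
  classical
  by_cases hk : k = 0
  · subst hk
    exact ⟨1, fun n => by rw [map_one, esum_zero]⟩
  rw [← mem_stableRange]
  change _ ∈ (stableRange F Ω L).toNonUnitalSubring
  refine esum_mem (N := fun n => n) (R := fun n => L ⊗[F] TPow F n (MvPolynomial Ω F))
    (fun n => insL F n L) (stableRange F Ω L).toNonUnitalSubring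
    (extIdeal L (augIdeal F Ω))
    {x | ∃ (c : L) (μ : Ω →₀ ℕ), μ ∈ {μ : Ω →₀ ℕ | μ ≠ 0} ∧
      x = c ⊗ₜ[F] MvPolynomial.monomial μ (1 : F)} ?_ ?_ ?_ (lTensor_augIncl_mem z) hk
  · rintro _ ⟨c, μ, hμ, rfl⟩
    refine tmul_mem_extIdeal c ((mem_augIdeal _).2 ?_)
    rw [MvPolynomial.coeff_monomial, if_neg hμ]
  · refine (extIdeal_subset_closure _).trans (SetLike.coe_subset_coe.2
      (AddSubmonoid.closure_le.2 ?_))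
    rintro _ ⟨c, a, ha, rfl⟩
    refine tmul_mem_closure_monomial _ c a fun μ hμ h => ?_
    rw [h] at hμ
    exact MvPolynomial.mem_support_iff.1 hμ ((mem_augIdeal _).1 ha)
  · rintro _ ⟨c, μ, hμ, rfl⟩ j -
    obtain ⟨y, hy⟩ := exists_kappaT_eq_elemSym F Ω j hμ
    refine (mem_stableRange F Ω L _).2 ⟨(c ^ j) ⊗ₜ y, fun n => ?_⟩
    rw [kappaL_tmul, hy, esum_insL_tmul]

end Generators

/-! ### Multiplicities of nontrivial monomials in a tuple, and multidegrees. -/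

section Types

variable {Ω : Type v} {n : ℕ}

/-- The multidegree of a monomial in the `e_{i,μ}`. -/
def multidegree (α : ℕ+ × PrimMon Ω →₀ ℕ) : Ω →₀ ℕ := α.sum fun p k => k • primPow p

open scoped Classical in
/-- The nonzero values of `f`, with multiplicities, are given by `α`. -/
def HasType (f : Fin n → Ω →₀ ℕ) (α : ℕ+ × PrimMon Ω →₀ ℕ) : Prop :=
  ∀ p, (Finset.univ.filter fun j => f j = primPow p).card = α p

theorem HasType.eq {f : Fin n → Ω →₀ ℕ} {α β : ℕ+ × PrimMon Ω →₀ ℕ} (hα : HasType f α)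
    (hβ : HasType f β) : α = β :=
  Finsupp.ext fun p => (hα p).symm.trans (hβ p)

theorem HasType.exists_mem {f : Fin n → Ω →₀ ℕ} {α : ℕ+ × PrimMon Ω →₀ ℕ} (h : HasType f α)
    {j : Fin n} (hj : f j ≠ 0) : ∃ p ∈ α.support, primPow p = f j := by
  classical
  obtain ⟨p, hp⟩ := exists_primPow hj
  refine ⟨p, Finsupp.mem_support_iff.2 ?_, hp⟩
  rw [← h p]
  exact Finset.card_ne_zero_of_mem (Finset.mem_filter.2 ⟨Finset.mem_univ j, hp.symm⟩)

theorem HasType.sum_eq {f : Fin n → Ω →₀ ℕ} {α : ℕ+ × PrimMon Ω →₀ ℕ} (h : HasType f α)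
    {M : Type*} [AddCommMonoid M] (g : (Ω →₀ ℕ) → M) (hg : g 0 = 0) :
    ∑ j, g (f j) = α.sum fun p k => k • g (primPow p) := by
  classical
  rw [← Finset.sum_fiberwise_of_maps_to (s := Finset.univ)
    (t := insert 0 (α.support.image primPow)) (g := f)]
  · rw [Finset.sum_insert, Finset.sum_image (fun x _ y _ hxy => primPow_injective hxy)]
    · rw [Finset.sum_eq_zero, zero_add]
      · refine Finset.sum_congr rfl fun p _ => ?_
        rw [Finset.sum_congr rfl fun j hj => congrArg g (Finset.mem_filter.1 hj).2,
          Finset.sum_const, ← h p]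
      · intro j hj
        rw [(Finset.mem_filter.1 hj).2, hg]
    · intro h0
      obtain ⟨p, -, hp⟩ := Finset.mem_image.1 h0
      exact primPow_ne_zero p hp
  · intro j _
    by_cases hj : f j = 0
    · rw [hj]; exact Finset.mem_insert_self _ _
    · obtain ⟨p, hp, hpj⟩ := h.exists_mem hj
      exact Finset.mem_insert_of_mem (Finset.mem_image.2 ⟨p, hp, hpj⟩)

theorem HasType.sum_eq_multidegree {f : Fin n → Ω →₀ ℕ} {α : ℕ+ × PrimMon Ω →₀ ℕ}
    (h : HasType f α) : ∑ j, f j = multidegree α :=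
  h.sum_eq (fun μ => μ) rfl

open scoped Classical in
theorem HasType.card_eq {f : Fin n → Ω →₀ ℕ} {α : ℕ+ × PrimMon Ω →₀ ℕ}
    (h : HasType f α) : (Finset.univ.filter fun j => f j ≠ 0).card = α.degree := by
  have := h.sum_eq (fun μ => if μ = 0 then (0 : ℕ) else 1) (if_pos rfl)
  simp only [primPow_ne_zero, if_false, smul_eq_mul, mul_one] at this
  rw [Finset.card_filter, Finsupp.degree_apply]
  simp only [ite_not]
  exact this

theorem exists_hasType (α : ℕ+ × PrimMon Ω →₀ ℕ) (hn : α.degree ≤ n) :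
    ∃ f : Fin n → Ω →₀ ℕ, HasType f α := by
  classical
  -- One slot is reserved for each monomial counted with multiplicity, and every other slot is
  -- filled with the trivial monomial.
  have hcard : Fintype.card (Σ p : α.support, Fin (α p)) ≤ Fintype.card (Fin n) := by
    rw [Fintype.card_sigma, Fintype.card_fin]
    simp only [Fintype.card_fin]
    rw [Finset.sum_coe_sort α.support (fun p => α p)]
    exact hn
  obtain ⟨ι⟩ := Function.Embedding.nonempty_of_card_le hcard
  refine ⟨Function.extend ι (fun s => primPow (s.1 : ℕ+ × PrimMon Ω)) 0, fun p => ?_⟩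
  by_cases hp : p ∈ α.support
  · have : (Finset.univ.filter fun j => Function.extend ι
        (fun s => primPow (s.1 : ℕ+ × PrimMon Ω)) 0 j = primPow p) =
        (Finset.univ : Finset (Fin (α p))).image fun t => ι ⟨⟨p, hp⟩, t⟩ := by
      ext j
      simp only [Finset.mem_filter, Finset.mem_univ, true_and, Finset.mem_image]
      constructor
      · intro h
        by_cases hj : ∃ s, ι s = j
        · obtain ⟨⟨⟨q, hq⟩, t⟩, rfl⟩ := hj
          rw [ι.injective.extend_apply] at h
          obtain rfl := primPow_injective h
          exact ⟨t, rfl⟩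
        · rw [Function.extend_apply' _ _ _ hj] at h
          exact absurd h.symm (primPow_ne_zero p)
      · rintro ⟨t, rfl⟩
        rw [ι.injective.extend_apply]
    rw [this, Finset.card_image_of_injective, Finset.card_univ, Fintype.card_fin]
    intro t t' h
    simpa using ι.injective h
  · rw [Finsupp.notMem_support_iff.1 hp, Finset.card_eq_zero, Finset.filter_eq_empty_iff]
    intro j _ h
    by_cases hj : ∃ s, ι s = j
    · obtain ⟨⟨⟨q, hq⟩, t⟩, rfl⟩ := hj
      rw [ι.injective.extend_apply] at h
      obtain rfl := primPow_injective h
      exact hp hq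
    · rw [Function.extend_apply' _ _ _ hj] at h
      exact primPow_ne_zero p h.symm

/-- Every `p` in the support of such an `α` has `primPow p ≤ d`, which leaves finitely many, and its
multiplicity is at most the total degree of `d` because `primPow p ≠ 0`. -/
theorem finite_multidegree_eq (d : Ω →₀ ℕ) :
    {α : ℕ+ × PrimMon Ω →₀ ℕ | multidegree α = d}.Finite := by
  classical
  have hS : {p : ℕ+ × PrimMon Ω | primPow p ≤ d}.Finite :=
    (Set.finite_Iic d).preimage primPow_injective.injOn
  let S := hS.toFinset
  let b : ℕ+ × PrimMon Ω →₀ ℕ := ∑ p ∈ S, Finsupp.single p d.degree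
  refine (Set.finite_Iic b).subset fun α hα => ?_
  rw [Set.mem_Iic]
  intro p
  by_cases hp : α p = 0
  · rw [hp]; exact Nat.zero_le _
  have h1 : α p • primPow p ≤ d := by
    rw [← (show multidegree α = d from hα), multidegree, Finsupp.sum]
    exact Finset.single_le_sum (f := fun p => α p • primPow p) (fun _ _ => zero_le)
      (Finsupp.mem_support_iff.2 hp)
  have h2 : primPow p ≤ α p • primPow p := by
    intro x
    rw [Finsupp.smul_apply, smul_eq_mul]
    exact Nat.le_mul_of_pos_left _ (Nat.pos_of_ne_zero hp)
  have h3 : p ∈ S := hS.mem_toFinset.2 (h2.trans h1)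
  have h4 : b p = d.degree := by
    simp only [b, Finsupp.finsetSum_apply, Finsupp.single_apply, Finset.sum_ite_eq', h3, if_true]
  rw [h4]
  obtain ⟨x, hx⟩ := Finsupp.ne_iff.1 (primPow_ne_zero p)
  calc α p ≤ α p * primPow p x := Nat.le_mul_of_pos_right _ (Nat.pos_of_ne_zero hx)
    _ ≤ d x := h1 x
    _ ≤ d.degree := Finsupp.le_degree x d

end Types

/-! ### The multigrading of the tensor power and the homogeneity of `κ_n`. -/

section Grading

variable (F : Type u) [CommRing F] (Ω : Type v) (n : ℕ)

/-- The span of the tensor products of monomials with product of multidegree `d`. -/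
def tgrade (d : Ω →₀ ℕ) : Submodule F (TPow F n (MvPolynomial Ω F)) :=
  Submodule.span F {x | ∃ f : Fin n → Ω →₀ ℕ, ∑ j, f j = d ∧
    x = PiTensorProduct.tprod F fun j => MvPolynomial.monomial (f j) (1 : F)}

instance : SetLike.GradedMonoid (tgrade F Ω n) where
  one_mem := Submodule.subset_span ⟨0, by simp, rfl⟩
  mul_mem {d d'} x y hx hy := by
    have h := Submodule.mul_mem_mul hx hy
    rw [tgrade, tgrade, Submodule.span_mul_span] at h
    refine Submodule.span_mono ?_ h
    rintro _ ⟨_, ⟨f, hf, rfl⟩, _, ⟨g, hg, rfl⟩, rfl⟩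
    refine ⟨f + g, by rw [← hf, ← hg, ← Finset.sum_add_distrib]; rfl, ?_⟩
    simp only [PiTensorProduct.tprod_mul_tprod]
    congr 1
    funext j
    simp [MvPolynomial.monomial_mul]

open scoped Classical in
theorem tcoeff_monomial (f g : Fin n → Ω →₀ ℕ) :
    tcoeff F f (PiTensorProduct.tprod F fun j => MvPolynomial.monomial (g j) (1 : F)) =
      if f = g then 1 else 0 := by
  rw [tcoeff_tprod]
  have h : (∀ i, g i = f i) ↔ f = g := by
    rw [funext_iff]
    exact forall_congr' fun _ => eq_comm
  simp only [MvPolynomial.coeff_monomial, Fintype.prod_ite_zero, Finset.prod_const_one, h]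

theorem tcoeff_eq_zero_of_mem_tgrade {d : Ω →₀ ℕ} {x : TPow F n (MvPolynomial Ω F)}
    (hx : x ∈ tgrade F Ω n d) {f : Fin n → Ω →₀ ℕ} (hf : ∑ j, f j ≠ d) : tcoeff F f x = 0 := by
  have : tgrade F Ω n d ≤ LinearMap.ker (tcoeff F f) := by
    refine Submodule.span_le.2 ?_
    rintro _ ⟨g, hg, rfl⟩
    rw [SetLike.mem_coe, LinearMap.mem_ker, tcoeff_monomial, if_neg]
    rintro rfl
    exact hf hg
  exact this hx

theorem ins_monomial_mem_tgrade (j : Fin n) (μ : Ω →₀ ℕ) :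
    ins F n j (MvPolynomial.monomial μ (1 : F)) ∈ tgrade F Ω n μ := by
  classical
  refine Submodule.subset_span ⟨Pi.single j μ, by simp, ?_⟩
  rw [PiTensorProduct.singleAlgHom_apply]
  congr 1
  funext i
  rcases eq_or_ne i j with rfl | h
  · simp
  · simp [h]

theorem elemSym_monomial_mem_tgrade (k : ℕ) (μ : Ω →₀ ℕ) :
    (elemSym F n k (MvPolynomial.monomial μ (1 : F)) : TPow F n (MvPolynomial Ω F)) ∈
      tgrade F Ω n (k • μ) := by
  rw [coe_elemSym]
  refine sum_mem fun T hT => ?_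
  have := SetLike.prod_mem_graded (tgrade F Ω n) (fun _ => μ)
    (fun j => ins F n j (MvPolynomial.monomial μ (1 : F))) (F := T)
    (fun j _ => ins_monomial_mem_tgrade F Ω n j μ)
  rw [Finset.sum_const, (Finset.mem_powersetCard.1 hT).2] at this
  exact this

theorem kappaT_monomial_mem_tgrade (β : ℕ+ × PrimMon Ω →₀ ℕ) :
    kappaT F Ω n (MvPolynomial.monomial β 1) ∈ tgrade F Ω n (multidegree β) := by
  rw [MvPolynomial.monomial_eq, map_one, one_mul, Finsupp.prod, map_prod]
  refine SetLike.prod_mem_graded (tgrade F Ω n) (fun p => β p • primPow p) _ fun p _ => ?_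
  rw [map_pow]
  refine SetLike.pow_mem_graded _ ?_
  rw [kappaT_X]
  exact elemSym_monomial_mem_tgrade F Ω n p.1 p.2.1

end Grading

/-! ### Monomial multisymmetric functions as coefficients of stable expressions. -/

section Coefficients

variable (F : Type u) [CommRing F] {Ω : Type v}

theorem extForm_sum_X_tmul {r : ℕ} (ν : Fin r → Ω →₀ ℕ) (p : Fin r → MvPolynomial Ω F)
    (hp : ∀ i, p i = MvPolynomial.monomial (ν i) 1) (μ : Ω →₀ ℕ) :
    extForm F (MvPolynomial (Fin r) F) (MvPolynomial.lcoeff F μ)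
      (∑ i, MvPolynomial.X i ⊗ₜ[F] p i) =
      ∑ i, open scoped Classical in if ν i = μ then MvPolynomial.X i else 0 := by
  classical
  rw [map_sum]
  refine Finset.sum_congr rfl fun i _ => ?_
  rw [extForm_tmul, MvPolynomial.lcoeff_apply, hp, MvPolynomial.coeff_monomial]
  split_ifs <;> simp

-- As `ν` is injective, each factor is a single variable or zero, so the product is a single
-- monomial recording how often each value occurs, or zero.
open scoped Classical in
theorem coeff_prod_sum_X {n r : ℕ} (T : Finset (Fin n)) (f : Fin n → Ω →₀ ℕ)
    (ν : Fin r → Ω →₀ ℕ) (hν : Function.Injective ν) (ξ : Fin r →₀ ℕ) :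
    (∏ j ∈ T, ∑ i, if ν i = f j then (MvPolynomial.X i : MvPolynomial (Fin r) F) else 0).coeff ξ =
      if (∀ j ∈ T, ∃ i, ν i = f j) ∧ ∀ i, (T.filter fun j => f j = ν i).card = ξ i
        then 1 else 0 := by
  by_cases h : ∀ j ∈ T, ∃ i, ν i = f j
  · rcases isEmpty_or_nonempty (Fin r) with hr | hr
    · have hT : T = ∅ := Finset.eq_empty_of_forall_notMem fun j hj =>
        (h j hj).elim fun i _ => hr.elim i
      rw [hT, Subsingleton.elim ξ 0]
      simp
    choose! g hg using h
    have h1 : ∏ j ∈ T, ∑ i, (if ν i = f j then (MvPolynomial.X i : MvPolynomial (Fin r) F) else 0) =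
        MvPolynomial.monomial (∑ j ∈ T, Finsupp.single (g j) 1) 1 := by
      rw [MvPolynomial.monomial_sum_one]
      refine Finset.prod_congr rfl fun j hj => ?_
      rw [Finset.sum_eq_single (g j)]
      · rw [if_pos (hg j hj)]; rfl
      · intro i _ hi
        rw [if_neg]
        intro h
        exact hi (hν (h.trans (hg j hj).symm))
      · simp
    have h2 : (∑ j ∈ T, Finsupp.single (g j) 1 = ξ) ↔
        ∀ i, (T.filter fun j => f j = ν i).card = ξ i := by
      rw [Finsupp.ext_iff]
      refine forall_congr' fun i => ?_
      rw [Finsupp.finsetSum_apply, Finset.card_filter]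
      refine Eq.congr_left (Finset.sum_congr rfl fun j hj => ?_)
      rw [Finsupp.single_apply]
      refine if_congr ?_ rfl rfl
      rw [← hg j hj]
      exact ⟨fun h => by rw [h], fun h => hν h⟩
    rw [h1, MvPolynomial.coeff_monomial]
    refine if_congr ?_ rfl rfl
    rw [h2]
    exact ⟨fun h => ⟨fun j hj => ⟨g j, hg j hj⟩, h⟩, fun h => h.2⟩
  · rw [if_neg fun h' => h h'.1]
    push Not at h
    obtain ⟨j, hj, hj'⟩ := h
    rw [Finset.prod_eq_zero hj, MvPolynomial.coeff_zero]
    exact Finset.sum_eq_zero fun i _ => if_neg (hj' i)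

open scoped Classical in
/-- Among the coefficients of the stable expressions of the `e_m` there are elements of `E` which
are sent by all `κ_n` to the monomial multisymmetric functions. -/
theorem exists_coeff_data (α : ℕ+ × PrimMon Ω →₀ ℕ) :
    ∃ (r : ℕ) (a : Fin r → augIdeal F Ω) (ξ : Fin r →₀ ℕ),
      ∀ y : MvPolynomial (Fin r) F ⊗[F] ERing F Ω,
        (∀ n, kappaL F Ω (MvPolynomial (Fin r) F) n y =
          esum (insL F n (MvPolynomial (Fin r) F)) α.degree
            ((augIncl F Ω).lTensor (MvPolynomial (Fin r) F)
              (∑ i, MvPolynomial.X i ⊗ₜ[F] a i))) →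
        ∀ (n : ℕ) (f : Fin n → Ω →₀ ℕ),
          tcoeff F f (kappaT F Ω n
            (TensorProduct.lid F _ ((MvPolynomial.lcoeff F ξ).rTensor _ y))) =
          if HasType f α then 1 else 0 := by
  -- The generic combination of the distinct monomials in the support of `α` is used. Its
  -- coefficient at the exponent vector of multiplicities selects exactly the tuples of type `α`.
  let r := α.support.card
  let e : Fin r ≃ α.support := α.support.equivFin.symm
  let ν : Fin r → Ω →₀ ℕ := fun i => primPow (e i : ℕ+ × PrimMon Ω)
  have hν : Function.Injective ν := fun i j h => e.injective (Subtype.ext (primPow_injective h))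
  have hν0 : ∀ i, ν i ≠ 0 := fun i => primPow_ne_zero _
  let a : Fin r → augIdeal F Ω := fun i => ⟨MvPolynomial.monomial (ν i) 1,
    (mem_augIdeal _).2 (by rw [MvPolynomial.coeff_monomial, if_neg (hν0 i)])⟩
  let ξ : Fin r →₀ ℕ := Finsupp.equivFunOnFinite.symm fun i => α (e i)
  refine ⟨r, a, ξ, fun y hy n f => ?_⟩
  set z := (augIncl F Ω).lTensor (MvPolynomial (Fin r) F) (∑ i, MvPolynomial.X i ⊗ₜ[F] a i) with hz
  have hz0 : extForm F (MvPolynomial (Fin r) F) (MvPolynomial.lcoeff F 0) z = 0 :=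
    extForm_augIncl _
  have h1 : tcoeff F f (kappaT F Ω n
      (TensorProduct.lid F _ ((MvPolynomial.lcoeff F ξ).rTensor _ y))) =
      (extForm F _ (tcoeff F f) (esum (insL F n (MvPolynomial (Fin r) F)) α.degree z)).coeff ξ := by
    rw [← hy n, kappaL_eq_lTensor, ← MvPolynomial.lcoeff_apply, apply_extForm,
      lid_rTensor_lTensor]
    rfl
  have hz' : z = ∑ i, MvPolynomial.X i ⊗ₜ[F] (MvPolynomial.monomial (ν i) (1 : F)) := by
    rw [hz, map_sum]
    rfl
  rw [h1, extForm_esum _ _ _ _ _ hz0]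
  simp only [hz', extForm_sum_X_tmul F ν _ fun _ => rfl]
  have hcount : ∀ i, ((Finset.univ.filter fun j => f j ≠ 0).filter fun j => f j = ν i) =
      Finset.univ.filter fun j => f j = ν i := by
    intro i
    ext j
    simp only [Finset.mem_filter, Finset.mem_univ, true_and, and_iff_right_iff_imp]
    intro h
    rw [h]
    exact hν0 i
  by_cases hf : HasType f α
  · rw [if_pos hf, if_pos hf.card_eq, coeff_prod_sum_X F _ f ν hν, if_pos]
    refine ⟨fun j hj => ?_, fun i => ?_⟩
    · obtain ⟨p, hp, hpj⟩ := hf.exists_mem (Finset.mem_filter.1 hj).2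
      refine ⟨e.symm ⟨p, hp⟩, ?_⟩
      simp only [ν, Equiv.apply_symm_apply, hpj]
    · rw [hcount, hf (e i)]
      rfl
  · rw [if_neg hf]
    split_ifs with hc
    · rw [coeff_prod_sum_X F _ f ν hν, if_neg]
      rintro ⟨h2, h3⟩
      refine hf fun p => ?_
      by_cases hp : p ∈ α.support
      · have h4 := h3 (e.symm ⟨p, hp⟩)
        rw [hcount] at h4
        simpa [ν, ξ] using h4
      · rw [Finsupp.notMem_support_iff.1 hp, Finset.card_eq_zero, Finset.filter_eq_empty_iff]
        intro j _ h
        obtain ⟨i, hi⟩ := h2 j (Finset.mem_filter.2 ⟨Finset.mem_univ j, by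
          rw [h]; exact primPow_ne_zero p⟩)
        have : (e i : ℕ+ × PrimMon Ω) = p := primPow_injective (hi.trans h)
        exact hp (this ▸ (e i).2)
    · exact MvPolynomial.coeff_zero _

open scoped Classical in
theorem exists_stable_monomial (α : ℕ+ × PrimMon Ω →₀ ℕ) :
    ∃ y : ERing F Ω, ∀ (n : ℕ) (f : Fin n → Ω →₀ ℕ),
      tcoeff F f (kappaT F Ω n y) = if HasType f α then 1 else 0 := by
  obtain ⟨r, a, ξ, h⟩ := exists_coeff_data F α
  obtain ⟨y, hy⟩ := exists_kappaL_eq (L := MvPolynomial (Fin r) F) α.degree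
    (∑ i, MvPolynomial.X i ⊗ₜ[F] a i)
  exact ⟨_, h y hy⟩

end Coefficients

/-! ### Detection of elements of `L ⊗ E` by `κ_n` for large `n`, and a spanning family of `E`. -/

section Injectivity

variable {F : Type u} [CommRing F] {Ω : Type v}

theorem eq_zero_of_matrix_mul_eq_one {ι : Type*} [Fintype ι] [DecidableEq ι]
    {Q B : Matrix ι ι F} (h : Q * B = 1) {W : Type*} [AddCommGroup W] [Module F W] (l : ι → W)
    (hl : ∀ α, ∑ β, Q α β • l β = 0) : l = 0 := by
  have h' := mul_eq_one_comm.1 h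
  funext γ
  have h1 : ∑ α, B γ α • ∑ β, Q α β • l β = ∑ β, (B * Q) γ β • l β := by
    simp only [Finset.smul_sum, smul_smul, Matrix.mul_apply, Finset.sum_smul]
    exact Finset.sum_comm
  simp only [hl, smul_zero, Finset.sum_const_zero, h', Matrix.one_apply, ite_smul, one_smul,
    zero_smul, Finset.sum_ite_eq, Finset.mem_univ, if_true] at h1
  exact h1.symm

theorem tcoeff_kappaT_eq_sum {n : ℕ} {f : Fin n → Ω →₀ ℕ}
    (J : Finset (ℕ+ × PrimMon Ω →₀ ℕ)) (hJ : ∀ α, α ∈ J ↔ multidegree α = ∑ j, f j)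
    (y : ERing F Ω) :
    tcoeff F f (kappaT F Ω n y) =
      ∑ β ∈ J, tcoeff F f (kappaT F Ω n (MvPolynomial.monomial β 1)) * y.coeff β := by
  classical
  induction y using MvPolynomial.induction_on' with
  | add p q hp hq =>
    simp only [map_add, hp, hq, MvPolynomial.coeff_add, mul_add, Finset.sum_add_distrib]
  | monomial γ c =>
    simp only [MvPolynomial.coeff_monomial, mul_ite, mul_zero]
    have hc : MvPolynomial.monomial γ c = c • MvPolynomial.monomial γ (1 : F) := by
      rw [MvPolynomial.smul_monomial, smul_eq_mul, mul_one]
    rw [Finset.sum_ite_eq, hc, map_smul, map_smul, smul_eq_mul, mul_comm]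
    split_ifs with h
    · rfl
    · rw [tcoeff_eq_zero_of_mem_tgrade F Ω n (kappaT_monomial_mem_tgrade F Ω n γ), zero_mul]
      exact fun h' => h ((hJ γ).2 h'.symm)

theorem extForm_tcoeff_kappaL_eq_sum {L : Type w} [CommRing L] [Algebra F L] {n : ℕ}
    {f : Fin n → Ω →₀ ℕ}
    (J : Finset (ℕ+ × PrimMon Ω →₀ ℕ)) (hJ : ∀ α, α ∈ J ↔ multidegree α = ∑ j, f j)
    (y : L ⊗[F] ERing F Ω) :
    extForm F L (tcoeff F f) (kappaL F Ω L n y) =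
      ∑ β ∈ J, tcoeff F f (kappaT F Ω n (MvPolynomial.monomial β 1)) •
        extForm F L (MvPolynomial.lcoeff F β) y := by
  induction y with
  | zero => simp
  | add p q hp hq => simp only [map_add, hp, hq, smul_add, Finset.sum_add_distrib]
  | tmul c y =>
    simp only [kappaL_tmul, extForm_tmul, MvPolynomial.lcoeff_apply]
    rw [tcoeff_kappaT_eq_sum J hJ, Finset.sum_smul]
    simp only [smul_smul]

open scoped Classical in
/-- In each multidegree, for large `n`, the matrix of `κ_n` with respect to the monomials in the
`e_{i,μ}` and the monomial multisymmetric functions is invertible. -/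
theorem exists_block (M : (ℕ+ × PrimMon Ω →₀ ℕ) → ERing F Ω)
    (hM : ∀ α (n : ℕ) (f : Fin n → Ω →₀ ℕ),
      tcoeff F f (kappaT F Ω n (M α)) = if HasType f α then 1 else 0) (d : Ω →₀ ℕ)
    (J : Finset (ℕ+ × PrimMon Ω →₀ ℕ)) (hJ : ∀ α, α ∈ J ↔ multidegree α = d) :
    ∃ N, ∀ n ≥ N, ∃ f : J → Fin n → Ω →₀ ℕ, (∀ α, ∑ j, f α j = d) ∧
      Matrix.of (fun α β : J => tcoeff F (f α) (kappaT F Ω n (MvPolynomial.monomial β.1 1))) *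
        Matrix.of (fun β α : J => (M α.1).coeff β.1) = 1 := by
  classical
  -- Beyond this bound every type of multidegree `d` is realized by a tuple of length `n`; the
  -- coordinate at such a tuple picks out one `M α`.
  refine ⟨J.sup fun α => α.degree, fun n hn => ?_⟩
  have h1 : ∀ α : J, ∃ f : Fin n → Ω →₀ ℕ, HasType f α.1 := fun α =>
    exists_hasType α.1 ((Finset.le_sup (f := fun α => α.degree) α.2).trans hn)
  choose f hf using h1
  have hfd : ∀ α, ∑ j, f α j = d := fun α =>
    (hf α).sum_eq_multidegree.trans ((hJ α).1 α.2)
  refine ⟨f, hfd, ?_⟩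
  ext α α'
  rw [Matrix.mul_apply]
  simp only [Matrix.of_apply]
  rw [Finset.sum_coe_sort J fun β =>
    tcoeff F (f α) (kappaT F Ω n (MvPolynomial.monomial β 1)) * (M α'.1).coeff β,
    ← tcoeff_kappaT_eq_sum J (fun β => by rw [hJ, hfd]), hM, Matrix.one_apply]
  refine if_congr ⟨fun h => Subtype.ext ((hf α).eq h), fun h => h ▸ hf α⟩ rfl rfl

/-- By homogeneity only the coefficients of multidegree `d` enter these equations, and for large `n`
they satisfy a homogeneous linear system with the invertible matrix of `exists_block`. -/
theorem extForm_lcoeff_eq_zero {L : Type w} [CommRing L] [Algebra F L] (d : Ω →₀ ℕ) (n₀ : ℕ)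
    (y : L ⊗[F] ERing F Ω)
    (hy : ∀ n ≥ n₀, ∀ f : Fin n → Ω →₀ ℕ, ∑ j, f j = d →
      extForm F L (tcoeff F f) (kappaL F Ω L n y) = 0)
    {β : ℕ+ × PrimMon Ω →₀ ℕ} (hβ : multidegree β = d) :
    extForm F L (MvPolynomial.lcoeff F β) y = 0 := by
  classical
  choose M hM using exists_stable_monomial F (Ω := Ω)
  let J := (finite_multidegree_eq (Ω := Ω) d).toFinset
  have hJ : ∀ α, α ∈ J ↔ multidegree α = d := fun α => by simp [J]
  obtain ⟨N, hN⟩ := exists_block M hM d J hJ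
  obtain ⟨f, hfd, hf⟩ := hN (max N n₀) (le_max_left _ _)
  have := eq_zero_of_matrix_mul_eq_one hf
    (fun β : J => extForm F L (MvPolynomial.lcoeff F β.1) y) (fun α => by
      have h := hy _ (le_max_right N n₀) (f α) (hfd α)
      rw [extForm_tcoeff_kappaL_eq_sum J (fun β => by rw [hJ, hfd])] at h
      rw [← h]
      exact Finset.sum_coe_sort J fun β =>
        tcoeff F (f α) (kappaT F Ω _ (MvPolynomial.monomial β 1)) •
          extForm F L (MvPolynomial.lcoeff F β) y)
  exact congrFun this ⟨β, (hJ β).2 hβ⟩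

theorem extForm_coord_eq_repr {L : Type w} [CommRing L] [Algebra F L] {M : Type*} {κ : Type*}
    [AddCommGroup M] [Module F M] (b : Module.Basis κ F M) (y : L ⊗[F] M) (i : κ) :
    (b.baseChange L).repr y i = extForm F L (b.coord i) y := by
  induction y with
  | zero => simp
  | add p q hp hq => simp only [map_add, Finsupp.add_apply, hp, hq]
  | tmul c y => simp [extForm_tmul]

/-- An element of `L ⊗ E` is determined by its images under `κ_n` for large `n`. -/
theorem eq_of_kappaL_eq {L : Type w} [CommRing L] [Algebra F L] (n₀ : ℕ)
    {x y : L ⊗[F] ERing F Ω} (h : ∀ n ≥ n₀, kappaL F Ω L n x = kappaL F Ω L n y) : x = y := by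
  refine ((MvPolynomial.basisMonomials (ℕ+ × PrimMon Ω) F).baseChange L).ext_elem fun β => ?_
  rw [extForm_coord_eq_repr, extForm_coord_eq_repr, ← sub_eq_zero, ← map_sub]
  refine extForm_lcoeff_eq_zero (multidegree β) n₀ (x - y) (fun n hn f _ => ?_) rfl
  rw [map_sub, h n hn, sub_self, map_zero]

open scoped Classical in
/-- The elements of `E` which are sent to the monomial multisymmetric functions span `E`. -/
theorem mem_span_stable_monomials (M : (ℕ+ × PrimMon Ω →₀ ℕ) → ERing F Ω)
    (hM : ∀ α (n : ℕ) (f : Fin n → Ω →₀ ℕ),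
      tcoeff F f (kappaT F Ω n (M α)) = if HasType f α then 1 else 0) (y : ERing F Ω) :
    y ∈ Submodule.span F (Set.range M) := by
  classical
  -- Each `M α` is homogeneous, because its images under all `κ_n` are; hence the inversion can be
  -- done inside one multidegree.
  have hhom : ∀ α β, multidegree β ≠ multidegree α → (M α).coeff β = 0 := by
    intro α β hαβ
    have := extForm_lcoeff_eq_zero (L := F) (multidegree β) 0 (1 ⊗ₜ M α) (fun n _ f hf => by
      rw [kappaL_tmul, extForm_tmul, hM, if_neg, zero_smul]
      intro h
      exact hαβ (hf.symm.trans h.sum_eq_multidegree)) rfl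
    rw [extForm_tmul] at this
    simpa using this
  suffices h : ∀ γ, MvPolynomial.monomial γ (1 : F) ∈ Submodule.span F (Set.range M) by
    rw [y.as_sum]
    refine sum_mem fun γ _ => ?_
    have hc : MvPolynomial.monomial γ (y.coeff γ) =
        y.coeff γ • MvPolynomial.monomial γ (1 : F) := by
      rw [MvPolynomial.smul_monomial, smul_eq_mul, mul_one]
    rw [hc]
    exact Submodule.smul_mem _ _ (h γ)
  intro γ
  let J := (finite_multidegree_eq (Ω := Ω) (multidegree γ)).toFinset
  have hJ : ∀ α, α ∈ J ↔ multidegree α = multidegree γ := fun α => by simp [J]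
  obtain ⟨N, hN⟩ := exists_block M hM (multidegree γ) J hJ
  obtain ⟨f, hfd, hf⟩ := hN N le_rfl
  -- The matrices are square over a commutative ring, so the inverse is two-sided; the other product
  -- expresses monomials through the `M α`.
  have hf' := mul_eq_one_comm.1 hf
  have key : MvPolynomial.monomial γ (1 : F) = ∑ α : J,
      tcoeff F (f α) (kappaT F Ω N (MvPolynomial.monomial γ 1)) • M α.1 := by
    ext β
    rw [MvPolynomial.coeff_sum, MvPolynomial.coeff_monomial]
    simp only [MvPolynomial.coeff_smul, smul_eq_mul]
    by_cases hβ : β ∈ J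
    · have := congrFun (congrFun hf' ⟨β, hβ⟩) ⟨γ, (hJ γ).2 rfl⟩
      rw [Matrix.mul_apply, Matrix.one_apply] at this
      simp only [Matrix.of_apply, Subtype.mk.injEq] at this
      simp only [mul_comm _ (MvPolynomial.coeff β _), this, eq_comm]
    · rw [if_neg, Finset.sum_eq_zero]
      · intro α _
        rw [hhom α.1 β, mul_zero]
        rw [(hJ _).1 α.2]
        exact fun h => hβ ((hJ β).2 h)
      · rintro rfl
        exact hβ ((hJ γ).2 rfl)
  rw [key]
  exact sum_mem fun α _ => Submodule.smul_mem _ _ (Submodule.subset_span ⟨α.1, rfl⟩)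

end Injectivity

/-! ### Existence, uniqueness and homogeneity of the stable law. -/

section Law

variable {F : Type u} [CommRing F] {Ω : Type v}

theorem lTensor_rTensor_comm {S S' M M' : Type*} [AddCommMonoid S] [Module F S]
    [AddCommMonoid S'] [Module F S'] [AddCommMonoid M] [Module F M] [AddCommMonoid M']
    [Module F M'] (g : S →ₗ[F] S') (h : M →ₗ[F] M') (x : S ⊗[F] M) :
    h.lTensor S' (g.rTensor M x) = g.rTensor M' (h.lTensor S x) := by
  induction x with
  | zero => simp
  | tmul c x => simp
  | add x y hx hy => simp only [map_add, hx, hy]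

/-- A commutative semiring which is an algebra over a ring is a ring. -/
abbrev commRingOfAlgebra (F : Type u) [CommRing F] (L : Type w) [CommSemiring L] [Algebra F L] :
    CommRing L :=
  { ‹CommSemiring L›, Algebra.semiringToRing F with }

theorem exists_lTensor_kappaT_eq (L : Type u) [CommSemiring L] [Algebra F L] (m : ℕ)
    (z : L ⊗[F] augIdeal F Ω) : ∃ y : L ⊗[F] ERing F Ω, ∀ n,
      (kappaT F Ω n).toLinearMap.lTensor L y =
        (elemLaw F n m).toFun' L ((augIncl F Ω).lTensor L z) := by
  let _ := commRingOfAlgebra F L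
  obtain ⟨y, hy⟩ := exists_kappaL_eq m z
  refine ⟨y, fun n => ?_⟩
  rw [← kappaL_eq_lTensor]
  exact (hy n).trans (elemLaw_apply F n L m _).symm

theorem eq_of_lTensor_kappaT_eq (L : Type u) [CommSemiring L] [Algebra F L] (n₀ : ℕ)
    {x y : L ⊗[F] ERing F Ω} (h : ∀ n ≥ n₀, (kappaT F Ω n).toLinearMap.lTensor L x =
      (kappaT F Ω n).toLinearMap.lTensor L y) : x = y := by
  let _ := commRingOfAlgebra F L
  refine eq_of_kappaL_eq (L := L) n₀ fun n hn => ?_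
  rw [kappaL_eq_lTensor, kappaL_eq_lTensor]
  exact h n hn

/-- The values are chosen separately over each `L`. They are compatible with base change because the
`κ_n` determine them and the laws `e_m` are compatible. -/
theorem exists_law (m : ℕ) : ∃ φ : augIdeal F Ω →ₚₗ[F] ERing F Ω,
    ∀ (L : Type u) [CommSemiring L] [Algebra F L] (z : L ⊗[F] augIdeal F Ω) (n : ℕ),
      (kappaT F Ω n).toLinearMap.lTensor L (φ.toFun' L z) =
        (elemLaw F n m).toFun' L ((augIncl F Ω).lTensor L z) := by
  refine ⟨⟨fun L _ _ z => (exists_lTensor_kappaT_eq L m z).choose,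
    fun {S _ _ S' _ _} g => funext fun z => ?_⟩,
    fun L _ _ z => (exists_lTensor_kappaT_eq L m z).choose_spec⟩
  refine eq_of_lTensor_kappaT_eq S' 0 fun n _ => ?_
  rw [Function.comp_apply, Function.comp_apply, lTensor_rTensor_comm,
    (exists_lTensor_kappaT_eq S m z).choose_spec,
    (exists_lTensor_kappaT_eq S' m (g.toLinearMap.rTensor _ z)).choose_spec,
    PolynomialLaw.isCompat_apply', lTensor_rTensor_comm]

theorem IsStableLaw.eq {m : ℕ} {φ ψ : augIdeal F Ω →ₚₗ[F] ERing F Ω} (hφ : IsStableLaw m φ)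
    (hψ : IsStableLaw m ψ) : φ = ψ := by
  ext L _ _ z
  obtain ⟨a, ha⟩ := hφ L z
  obtain ⟨b, hb⟩ := hψ L z
  exact eq_of_lTensor_kappaT_eq L (max a b) fun n hn =>
    (ha n ((le_max_left _ _).trans hn)).trans (hb n ((le_max_right _ _).trans hn)).symm

theorem existsUnique_isStableLaw (m : ℕ) :
    ∃! φ : augIdeal F Ω →ₚₗ[F] ERing F Ω, IsStableLaw m φ := by
  obtain ⟨φ, hφ⟩ := exists_law (F := F) (Ω := Ω) m
  exact ⟨φ, fun L _ _ z => ⟨0, fun n _ => hφ L z n⟩,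
    fun ψ hψ => hψ.eq fun L _ _ z => ⟨0, fun n _ => hφ L z n⟩⟩

theorem isStableLaw_stableLaw (m : ℕ) : IsStableLaw m (stableLaw F Ω m) :=
  Classical.epsilon_spec (existsUnique_isStableLaw m).exists

/-- The defining property asks only for large `n`, but the law constructed in `exists_law` satisfies
it for all `n`, and uniqueness identifies the two. The kernel of a fixed `κ_n` requires this
stronger form. -/
theorem lTensor_kappaT_stableLaw (m : ℕ) (L : Type u) [CommSemiring L] [Algebra F L]
    (z : L ⊗[F] augIdeal F Ω) (n : ℕ) :
    (kappaT F Ω n).toLinearMap.lTensor L ((stableLaw F Ω m).toFun' L z) =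
      (elemLaw F n m).toFun' L ((augIncl F Ω).lTensor L z) := by
  obtain ⟨φ, hφ⟩ := exists_law (F := F) (Ω := Ω) m
  have : stableLaw F Ω m = φ :=
    (isStableLaw_stableLaw m).eq fun L _ _ z => ⟨0, fun n _ => hφ L z n⟩
  rw [this]
  exact hφ L z n

theorem lTensor_smul' {L : Type w} [CommSemiring L] [Algebra F L] {M M' : Type*}
    [AddCommMonoid M] [Module F M] [AddCommMonoid M'] [Module F M'] (g : M →ₗ[F] M') (c : L)
    (x : L ⊗[F] M) : g.lTensor L (c • x) = c • g.lTensor L x := by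
  induction x with
  | zero => simp
  | tmul d x => simp [TensorProduct.smul_tmul']
  | add x y hx hy => simp only [smul_add, map_add, hx, hy]

theorem esum_insL_smul {A : Type v} [CommRing A] [Algebra F A] {L : Type w} [CommRing L]
    [Algebra F L] (n m : ℕ) (c : L) (z : L ⊗[F] A) :
    esum (insL F n L) m (c • z) = c ^ m • esum (insL F n L) m z := by
  have h : ∀ j, insL F n L j (c • z) = c • insL F n L j z := fun j => by
    rw [← baseChange_ins, ← baseChange_ins, map_smul]
  rw [esum, esum, Finset.smul_sum]
  refine Finset.sum_congr rfl fun T hT => ?_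
  simp only [h]
  rw [Finset.prod_smul, Finset.prod_const, (Finset.mem_powersetCard.1 hT).2]

theorem isHomogeneousLaw_elemLaw {A : Type v} [CommRing A] [Algebra F A] (n m : ℕ) :
    IsHomogeneousLaw m (elemLaw F n m : A →ₚₗ[F] TPow F n A) := by
  intro L _ _ c z
  let _ := commRingOfAlgebra F L
  exact (elemLaw_apply F n L m (c • z)).trans ((esum_insL_smul n m c z).trans
    (congrArg (c ^ m • ·) (elemLaw_apply F n L m z)).symm)

theorem isHomogeneousLaw_stableLaw (m : ℕ) : IsHomogeneousLaw m (stableLaw F Ω m) := by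
  intro L _ _ c z
  refine eq_of_lTensor_kappaT_eq L 0 fun n _ => ?_
  rw [lTensor_kappaT_stableLaw, lTensor_smul', lTensor_smul', lTensor_kappaT_stableLaw,
    isHomogeneousLaw_elemLaw]

end Law

/-! ### The kernel of `κ_n`. -/

section Kernel

variable {F : Type u} [CommRing F] {Ω : Type v}

theorem kappaT_lawCoeff_stableLaw (n m : ℕ) {r : ℕ} (a : Fin r → augIdeal F Ω)
    (ξ : Fin r →₀ ℕ) : kappaT F Ω n (lawCoeff (stableLaw F Ω m) a ξ) =
      lawCoeff (elemLaw F n m) (fun i => augIncl F Ω (a i)) ξ := by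
  rw [lawCoeff, ← AlgHom.toLinearMap_apply, ← lid_rTensor_lTensor, lTensor_kappaT_stableLaw,
    map_sum, lawCoeff]
  simp only [LinearMap.lTensor_tmul]

theorem lawCoeff_elemLaw_eq_zero {A : Type v} [CommRing A] [Algebra F A] {n m : ℕ} (h : n < m)
    {r : ℕ} (a : Fin r → A) (ξ : Fin r →₀ ℕ) : lawCoeff (elemLaw F n m) a ξ = 0 := by
  rw [lawCoeff, elemLaw_apply, esum_eq_zero _ h, map_zero, map_zero]

theorem mem_ker_kappa (n : ℕ) (y : ERing F Ω) : kappa F Ω n y = 0 ↔ kappaT F Ω n y = 0 :=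
  (Subtype.ext_iff (a2 := (0 : TS F n (MvPolynomial Ω F))))

theorem kappa_of_mem_stableCoeffs {n : ℕ} {y : ERing F Ω} (hy : y ∈ stableCoeffs F Ω n) :
    kappa F Ω n y = 0 := by
  obtain ⟨m, hm, r, a, ξ, rfl⟩ := hy
  rw [mem_ker_kappa, kappaT_lawCoeff_stableLaw, lawCoeff_elemLaw_eq_zero hm]

theorem ker_kappa (n : ℕ) :
    LinearMap.ker (kappa F Ω n).toLinearMap = Submodule.span F (stableCoeffs F Ω n) := by
  classical
  refine le_antisymm (fun y hy => ?_) (Submodule.span_le.2 fun y hy =>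
    kappa_of_mem_stableCoeffs hy)
  replace hy : kappaT F Ω n y = 0 := (mem_ker_kappa n y).1 hy
  choose r a ξ h using exists_coeff_data F (Ω := Ω)
  let M : (ℕ+ × PrimMon Ω →₀ ℕ) → ERing F Ω := fun α =>
    lawCoeff (stableLaw F Ω α.degree) (a α) (ξ α)
  have hM : ∀ α (n : ℕ) (f : Fin n → Ω →₀ ℕ),
      tcoeff F f (kappaT F Ω n (M α)) = if HasType f α then 1 else 0 := fun α =>
    h α _ fun n => by
      rw [kappaL_eq_lTensor, lTensor_kappaT_stableLaw, elemLaw_apply]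
  obtain ⟨c, rfl⟩ := Finsupp.mem_span_range_iff_exists_finsupp.1 (mem_span_stable_monomials M hM y)
  refine Submodule.sum_mem _ fun α hα => Submodule.smul_mem _ _ (Submodule.subset_span ?_)
  refine ⟨α.degree, ?_, r α, a α, ξ α, rfl⟩
  -- If `|α| ≤ n`, a tuple of type `α` exists, and the coordinate there isolates the coefficient `c
  -- α`, which must then vanish.
  by_contra hn
  obtain ⟨f, hf⟩ := exists_hasType α (not_lt.1 hn)
  have h1 := congrArg (tcoeff F f) hy
  rw [Finsupp.sum, map_sum, map_sum, map_zero, Finset.sum_eq_single α] at h1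
  · rw [map_smul, map_smul, hM, if_pos hf, smul_eq_mul, mul_one] at h1
    exact Finsupp.mem_support_iff.1 hα h1
  · intro β _ hβ
    rw [map_smul, map_smul, hM, if_neg fun h => hβ (h.eq hf), smul_zero]
  · exact fun h => absurd hα h

end Kernel

/-! ### Surjectivity of `κ_n`. -/

section Surjectivity

variable {F : Type u} [CommRing F] {Ω : Type v} {n : ℕ}

theorem tcoeff_permHom (σ : Equiv.Perm (Fin n)) (f : Fin n → Ω →₀ ℕ)
    (x : TPow F n (MvPolynomial Ω F)) :
    tcoeff F (fun j => f (σ j)) (permHom F n _ σ x) = tcoeff F f x := by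
  induction x using PiTensorProduct.induction_on with
  | add x y hx hy => rw [map_add, map_add, map_add, hx, hy]
  | smul_tprod c a =>
    rw [map_smul, map_smul, map_smul, permHom_tprod, tcoeff_tprod, tcoeff_tprod]
    congr 1
    exact Equiv.prod_comp σ fun j => (a j).coeff (f j)

-- The orbit sum of `f` is the coefficient, in the norm of the generic combination of the distinct
-- values of `f`, at the vector of multiplicities: two tuples with equal multiplicities differ by a
-- permutation.
open scoped Classical in
theorem exists_orbit_sum (f : Fin n → Ω →₀ ℕ) :
    ∃ (r : ℕ) (b : Fin r → MvPolynomial Ω F) (ξ : Fin r →₀ ℕ), ∀ g : Fin n → Ω →₀ ℕ,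
      tcoeff F g (lawCoeff (elemLaw F n n) b ξ) =
        if ∃ σ : Equiv.Perm (Fin n), g = fun j => f (σ j) then 1 else 0 := by
  let S := Finset.univ.image f
  let e : Fin S.card ≃ S := S.equivFin.symm
  let ν : Fin S.card → Ω →₀ ℕ := fun i => e i
  have hν : Function.Injective ν := fun i j h => e.injective (Subtype.ext h)
  have hfν : ∀ j, ∃ i, ν i = f j := fun j =>
    ⟨e.symm ⟨f j, Finset.mem_image_of_mem f (Finset.mem_univ j)⟩, by simp [ν]⟩
  refine ⟨S.card, fun i => MvPolynomial.monomial (ν i) 1, Finsupp.equivFunOnFinite.symm fun i =>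
    (Finset.univ.filter fun j => f j = ν i).card, fun g => ?_⟩
  rw [lawCoeff, ← apply_extForm, elemLaw_apply, extForm_esum_self, MvPolynomial.lcoeff_apply]
  simp only [extForm_sum_X_tmul F ν _ fun _ => rfl]
  rw [coeff_prod_sum_X F _ g ν hν]
  refine if_congr ⟨?_, ?_⟩ rfl rfl
  · rintro ⟨h1, h2⟩
    have h3 : ∀ μ, Nonempty ({j // g j = μ} ≃ {j // f j = μ}) := by
      intro μ
      refine ⟨Fintype.equivOfCardEq ?_⟩
      rw [Fintype.card_subtype, Fintype.card_subtype]
      by_cases hμ : ∃ i, ν i = μ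
      · obtain ⟨i, rfl⟩ := hμ
        exact h2 i
      · rw [Finset.filter_eq_empty_iff.2, Finset.filter_eq_empty_iff.2]
        · rintro j - rfl
          exact hμ (hfν j)
        · rintro j - rfl
          exact hμ (h1 j (Finset.mem_univ j))
    exact ⟨Equiv.ofFiberEquiv fun μ => (h3 μ).some, funext fun j =>
      (Equiv.ofFiberEquiv_map _ j).symm⟩
  · rintro ⟨σ, rfl⟩
    refine ⟨fun j _ => hfν _, fun i => ?_⟩
    change _ = (Finset.univ.filter fun j => f j = ν i).card
    exact Finset.card_equiv σ fun j => by simp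

/-- Symmetric tensors are linear combinations of coefficients of the norm law. -/
theorem mem_span_of_mem_TS {x : TPow F n (MvPolynomial Ω F)}
    (hx : x ∈ TS F n (MvPolynomial Ω F)) :
    x ∈ Submodule.span F {y | ∃ (r : ℕ) (b : Fin r → MvPolynomial Ω F) (ξ : Fin r →₀ ℕ),
      y = lawCoeff (elemLaw F n n) b ξ} := by
  classical
  have hinv : ∀ f (σ : Equiv.Perm (Fin n)), tcoeff F (fun j => f (σ j)) x = tcoeff F f x :=
    fun f σ => by
      conv_lhs => rw [← hx σ]
      exact tcoeff_permHom σ f x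
  clear hx
  -- Subtracting a multiple of the orbit sum through `f` clears the whole orbit of `f` and leaves
  -- the other coordinates unchanged, so the support shrinks.
  induction hk : (finite_support_tcoeff F x).toFinset.card using Nat.strong_induction_on
    generalizing x with
  | _ k ih =>
    subst hk
    by_cases h0 : ∀ f, tcoeff F f x = 0
    · have : x = 0 := tpow_ext F fun f => by rw [h0 f, map_zero]
      rw [this]
      exact zero_mem _
    push Not at h0
    obtain ⟨f, hf⟩ := h0
    obtain ⟨r, b, ξ, ho⟩ := exists_orbit_sum (F := F) f
    set o := lawCoeff (elemLaw F n n) b ξ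
    have hx' : ∀ g, tcoeff F g (x - tcoeff F f x • o) =
        if ∃ σ : Equiv.Perm (Fin n), g = fun j => f (σ j) then 0 else tcoeff F g x := by
      intro g
      rw [map_sub, map_smul, ho, smul_eq_mul]
      split_ifs with h
      · obtain ⟨σ, rfl⟩ := h
        rw [hinv, mul_one, sub_self]
      · rw [mul_zero, sub_zero]
    have h1 := ih _ (Finset.card_lt_card ?_) (x := x - tcoeff F f x • o) ?_ rfl
    · rw [← sub_add_cancel x (tcoeff F f x • o)]
      exact add_mem h1 (Submodule.smul_mem _ _ (Submodule.subset_span ⟨r, b, ξ, rfl⟩))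
    · refine Finset.ssubset_iff_subset_ne.2 ⟨fun g => ?_, fun h => ?_⟩
      · simp only [Set.Finite.mem_toFinset, Set.mem_ofPred_eq, hx']
        split_ifs
        · exact fun h => absurd rfl h
        · exact id
      · have hm : f ∈ (finite_support_tcoeff F x).toFinset := by simpa using hf
        rw [← h, Set.Finite.mem_toFinset, Set.mem_ofPred_eq, hx'] at hm
        exact hm (if_pos ⟨1, rfl⟩)
    · intro g σ
      rw [hx', hx', hinv]
      refine if_congr ⟨?_, ?_⟩ rfl rfl
      · rintro ⟨τ, h⟩
        refine ⟨σ.symm.trans τ, funext fun j => ?_⟩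
        have := congrFun h (σ.symm j)
        simpa using this
      · rintro ⟨τ, rfl⟩
        exact ⟨σ.trans τ, rfl⟩

theorem coe_elemSym_mem_range_kappaT (k : ℕ) (μ : Ω →₀ ℕ) :
    ∃ y, kappaT F Ω n y = (elemSym F n k (MvPolynomial.monomial μ (1 : F)) :
      TPow F n (MvPolynomial Ω F)) := by
  -- `e_k(1)` is an integer depending on `n`: harmless for a fixed `n`, whereas the stable statement
  -- needs `μ ≠ 0`.
  by_cases hμ : μ = 0
  · refine ⟨((Finset.powersetCard k (Finset.univ : Finset (Fin n))).card : ERing F Ω), ?_⟩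
    rw [hμ, coe_elemSym, map_natCast, esum]
    have h1 : MvPolynomial.monomial (0 : Ω →₀ ℕ) (1 : F) = 1 := rfl
    simp only [h1, map_one, Finset.prod_const_one, Finset.sum_const, nsmul_eq_mul, mul_one]
  · obtain ⟨y, hy⟩ := exists_kappaT_eq_elemSym F Ω k hμ
    exact ⟨y, hy n⟩

theorem esum_insL_mem_range_kappaL {L : Type w} [CommRing L] [Algebra F L] (k : ℕ)
    (z : L ⊗[F] MvPolynomial Ω F) : ∃ y, kappaL F Ω L n y = esum (insL F n L) k z := by
  by_cases hk : k = 0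
  · subst hk
    exact ⟨1, by rw [map_one, esum_zero]⟩
  let T : Subring (Unit → L ⊗[F] TPow F n (MvPolynomial Ω F)) :=
    (RingHom.pi fun _ : Unit => kappaL F Ω L n).range
  have h : (fun _ : Unit => esum (insL F n L) k z) ∈ T.toNonUnitalSubring := by
    refine esum_mem (N := fun _ : Unit => n)
      (R := fun _ : Unit => L ⊗[F] TPow F n (MvPolynomial Ω F)) (fun _ => insL F n L)
      T.toNonUnitalSubring ⊤
      {x | ∃ (c : L) (μ : Ω →₀ ℕ), μ ∈ (Set.univ : Set (Ω →₀ ℕ)) ∧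
        x = c ⊗ₜ[F] MvPolynomial.monomial μ (1 : F)} (fun _ _ => trivial) ?_ ?_ trivial hk
    · intro x _
      induction x with
      | zero => exact zero_mem _
      | add x y hx hy => exact add_mem (hx trivial) (hy trivial)
      | tmul c p => exact tmul_mem_closure_monomial _ c p fun _ _ => trivial
    · rintro _ ⟨c, μ, -, rfl⟩ j -
      obtain ⟨y, hy⟩ := coe_elemSym_mem_range_kappaT (F := F) (n := n) j μ
      refine ⟨(c ^ j) ⊗ₜ y, funext fun _ => ?_⟩
      rw [esum_insL_tmul, ← hy]
      rfl
  obtain ⟨y, hy⟩ := h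
  exact ⟨y, congrFun hy ()⟩

theorem kappa_surjective (n : ℕ) : Function.Surjective (kappa F Ω n) := by
  intro x
  have hx := mem_span_of_mem_TS x.2
  have h : Submodule.span F {y | ∃ (r : ℕ) (b : Fin r → MvPolynomial Ω F) (ξ : Fin r →₀ ℕ),
      y = lawCoeff (elemLaw F n n) b ξ} ≤ LinearMap.range (kappaT F Ω n).toLinearMap := by
    refine Submodule.span_le.2 ?_
    rintro _ ⟨r, b, ξ, rfl⟩
    obtain ⟨y, hy⟩ := esum_insL_mem_range_kappaL (n := n) (L := MvPolynomial (Fin r) F) n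
      (∑ i, MvPolynomial.X i ⊗ₜ[F] b i)
    refine ⟨TensorProduct.lid F _ ((MvPolynomial.lcoeff F ξ).rTensor _ y), ?_⟩
    rw [lawCoeff, elemLaw_apply, ← hy, kappaL_eq_lTensor, lid_rTensor_lTensor]
  obtain ⟨y, hy⟩ := h hx
  exact ⟨y, Subtype.ext hy⟩

end Surjectivity

/-! ### Extension of scalars for subspaces of algebras. -/

section BaseChangeIdeal

variable {F : Type u} [CommRing F] {L : Type w} [CommRing L] [Algebra F L]

theorem mul_mem_baseChange {R : Type v} [CommRing R] [Algebra F R] {p q r : Submodule F R}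
    (h : ∀ x ∈ p, ∀ y ∈ q, x * y ∈ r) {x y : L ⊗[F] R} (hx : x ∈ p.baseChange L)
    (hy : y ∈ q.baseChange L) : x * y ∈ r.baseChange L := by
  rw [Submodule.baseChange_eq_span] at hx hy
  induction hx using Submodule.span_induction with
  | zero => rw [zero_mul]; exact zero_mem _
  | add a b _ _ ha hb => rw [add_mul]; exact add_mem ha hb
  | smul c a _ ha => rw [smul_mul_assoc]; exact Submodule.smul_mem _ _ ha
  | mem a ha =>
    induction hy using Submodule.span_induction with
    | zero => rw [mul_zero]; exact zero_mem _
    | add b c _ _ hb hc => rw [mul_add]; exact add_mem hb hc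
    | smul c b _ hb => rw [mul_smul_comm]; exact Submodule.smul_mem _ _ hb
    | mem b hb =>
      obtain ⟨a, ha, rfl⟩ := ha
      obtain ⟨b, hb, rfl⟩ := hb
      simp only [TensorProduct.mk_apply, Algebra.TensorProduct.tmul_mul_tmul, mul_one]
      exact Submodule.tmul_mem_baseChange_of_mem _ (h a ha b hb)

/-- Applying `l` to the first factor commutes with the inclusion of `p`. This brings relations over
`F[t]` down to coefficients. -/
theorem lid_rTensor_mem {M : Type*} [AddCommGroup M] [Module F M] {p : Submodule F M}
    (l : L →ₗ[F] F) {x : L ⊗[F] M} (hx : x ∈ p.baseChange L) :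
    TensorProduct.lid F M (l.rTensor M x) ∈ p := by
  obtain ⟨x, rfl⟩ := hx
  have h : (p.subtype.baseChange L) x = p.subtype.lTensor L x := rfl
  rw [h, lid_rTensor_lTensor]
  exact Subtype.property _

end BaseChangeIdeal

/-! ### Invariance of `e_k` modulo the ideal generated by the `e_j(g)`. -/

section Relations

variable {F : Type u} [CommRing F] {A : Type v} [CommRing A] [Algebra F A] (n : ℕ)

/-- The ideal of `TSⁿ(A)` generated by the `e_k(g)` with `1 ≤ k ≤ n` and `g ∈ I`. -/
def elemIdeal (I : Ideal A) : Ideal (TS F n A) :=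
  Ideal.span {y | ∃ k, 1 ≤ k ∧ k ≤ n ∧ ∃ g ∈ I, y = elemSym F n k g}

/-- The ideal generated by the `e_k(g)`, as a subspace of the tensor power. -/
def elemSubmodule (I : Ideal A) : Submodule F (TPow F n A) :=
  ((elemIdeal n I).restrictScalars F).map (TS F n A).val.toLinearMap

variable {n}

theorem mem_elemSubmodule {I : Ideal A} {x : TS F n A} :
    (x : TPow F n A) ∈ elemSubmodule n I ↔ x ∈ elemIdeal n I := by
  constructor
  · rintro ⟨y, hy, h⟩
    rwa [← Subtype.ext h]
  · exact fun h => ⟨x, h, rfl⟩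

theorem elemSubmodule_le (I : Ideal A) :
    elemSubmodule n I ≤ Subalgebra.toSubmodule (TS F n A) := by
  rintro _ ⟨y, -, rfl⟩
  exact y.2

theorem mul_mem_elemSubmodule {I : Ideal A} {x y : TPow F n A} (hx : x ∈ TS F n A)
    (hy : y ∈ elemSubmodule n I) : x * y ∈ elemSubmodule n I := by
  obtain ⟨y, hy, rfl⟩ := hy
  exact ⟨⟨x, hx⟩ * y, Ideal.mul_mem_left _ _ hy, rfl⟩

theorem elemSym_mem_elemSubmodule {I : Ideal A} {k : ℕ} (hk : k ≠ 0) {g : A} (hg : g ∈ I) :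
    (elemSym F n k g : TPow F n A) ∈ elemSubmodule n I := by
  by_cases h : k ≤ n
  · exact mem_elemSubmodule.2 (Ideal.subset_span ⟨k, Nat.pos_of_ne_zero hk, h, g, hg, rfl⟩)
  · rw [coe_elemSym, esum_eq_zero _ (not_le.1 h)]
    exact zero_mem _

/-- A subspace of an algebra which is closed under multiplication, as a ring of families indexed
by the unit type. -/
def unitSubring {R : Type*} [CommRing R] (p : AddSubgroup R) (hp : ∀ x ∈ p, ∀ y ∈ p, x * y ∈ p) :
    NonUnitalSubring (Unit → R) where
  carrier := {x | x () ∈ p}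
  add_mem' := p.add_mem
  zero_mem' := p.zero_mem
  neg_mem' := p.neg_mem
  mul_mem' hx hy := hp _ hx _ hy

variable {L : Type w} [CommRing L] [Algebra F L]

theorem esum_insL_mem_baseChange_TS (k : ℕ) (z : L ⊗[F] A) :
    esum (insL F n L) k z ∈ (Subalgebra.toSubmodule (TS F n A)).baseChange L := by
  by_cases hk : k = 0
  · subst hk
    rw [esum_zero, Algebra.TensorProduct.one_def]
    exact Submodule.tmul_mem_baseChange_of_mem _ (TS F n A).one_mem
  let p := ((Subalgebra.toSubmodule (TS F n A)).baseChange L).toAddSubgroup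
  have h : (fun _ : Unit => esum (insL F n L) k z) ∈ unitSubring p fun x hx y hy =>
      mul_mem_baseChange (fun a ha b hb => (TS F n A).mul_mem ha hb) hx hy := by
    refine esum_mem (N := fun _ : Unit => n)
      (R := fun _ : Unit => L ⊗[F] TPow F n A) (fun _ => insL F n L) _ ⊤
      {x | ∃ (c : L) (a : A), x = c ⊗ₜ[F] a} (fun _ _ => trivial) ?_ ?_ trivial hk
    · intro x _
      induction x with
      | zero => exact zero_mem _
      | add x y hx hy => exact add_mem (hx trivial) (hy trivial)
      | tmul c a => exact AddSubmonoid.subset_closure ⟨c, a, rfl⟩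
    · rintro _ ⟨c, a, rfl⟩ j -
      rw [esum_insL_tmul]
      exact Submodule.tmul_mem_baseChange_of_mem _ (elemSym F n j a).2
  exact h

theorem coeff_normSeries_insL_mem {I : Ideal A} (u : PowerSeries (L ⊗[F] A))
    (h0 : PowerSeries.constantCoeff u = 1)
    (hu : PowerSeries.map (Ideal.Quotient.mk (extIdeal L I)) u = 1) {k : ℕ} (hk : k ≠ 0) :
    PowerSeries.coeff k (normSeries (insL F n L) u) ∈ (elemSubmodule n I).baseChange L := by
  have hmul : ∀ a ∈ elemSubmodule (F := F) n I, ∀ b ∈ elemSubmodule (F := F) n I,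
      a * b ∈ elemSubmodule (F := F) n I := fun a ha b hb =>
    mul_mem_elemSubmodule (elemSubmodule_le I ha) hb
  let p := ((elemSubmodule (F := F) n I).baseChange L).toAddSubgroup
  have h : (fun _ : Unit => PowerSeries.coeff k (normSeries (insL F n L) u)) ∈
      unitSubring p fun x hx y hy => mul_mem_baseChange hmul hx hy := by
    refine coeff_normSeries_mem (N := fun _ : Unit => n)
      (R := fun _ : Unit => L ⊗[F] TPow F n A) (fun _ => insL F n L) _ (extIdeal L I)
      {x : L ⊗[F] A | ∃ (c : L) (a : A), a ∈ I ∧ x = c ⊗ₜ[F] a} ?_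
      (extIdeal_subset_closure I) ?_ u h0 hu k hk
    · rintro _ ⟨c, a, ha, rfl⟩
      exact tmul_mem_extIdeal c ha
    · rintro _ ⟨c, a, ha, rfl⟩ j hj
      rw [esum_insL_tmul]
      exact Submodule.tmul_mem_baseChange_of_mem _ (elemSym_mem_elemSubmodule hj ha)
  exact h

/-- Modulo the ideal generated by the `e_k(g)` with `g ∈ I`, the law `e_k` depends only on
classes modulo `I`. -/
theorem esum_sub_esum_mem {I : Ideal A} (k : ℕ) {f f' : L ⊗[F] A}
    (h : f - f' ∈ extIdeal L I) :
    esum (insL F n L) k f - esum (insL F n L) k f' ∈ (elemSubmodule n I).baseChange L := by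
  -- The quotient `u = (1 + ft)/(1 + f't) = 1 + (f - f')t/(1 + f't)` lies in `1 + tV⟦t⟧` for the
  -- extended ideal `V`, so the closure principle applies to its norm.
  obtain ⟨w, hw⟩ : IsUnit (1 + PowerSeries.C f' * PowerSeries.X) := by
    rw [PowerSeries.isUnit_iff_constantCoeff]
    simp
  let u : PowerSeries (L ⊗[F] A) :=
    1 + PowerSeries.C (f - f') *
      (PowerSeries.X * ((w⁻¹ : (PowerSeries (L ⊗[F] A))ˣ) : PowerSeries (L ⊗[F] A)))
  have hu0 : PowerSeries.constantCoeff u = 1 := by simp [u]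
  have hu1 : PowerSeries.map (Ideal.Quotient.mk (extIdeal L I)) u = 1 := by
    simp only [u, map_add, map_mul, map_one, PowerSeries.map_C]
    rw [Ideal.Quotient.eq_zero_iff_mem.2 h, map_zero, zero_mul, add_zero]
  have hfac : 1 + PowerSeries.C f * PowerSeries.X =
      (1 + PowerSeries.C f' * PowerSeries.X) * u := by
    have h1 : (1 + PowerSeries.C f' * PowerSeries.X) *
        ((w⁻¹ : (PowerSeries (L ⊗[F] A))ˣ) : PowerSeries (L ⊗[F] A)) = 1 := by
      rw [← hw, Units.mul_inv]
    simp only [u, map_sub]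
    linear_combination (-(PowerSeries.C f - PowerSeries.C f') * PowerSeries.X) * h1
  clear_value u
  obtain ⟨v, hv⟩ : ∃ v, normSeries (insL F n L) u = 1 + v := ⟨_, (add_sub_cancel 1 _).symm⟩
  have hv' : ∀ j, PowerSeries.coeff j v ∈ (elemSubmodule n I).baseChange L := by
    intro j
    have h1 := congrArg (PowerSeries.coeff j) hv
    rw [map_add, PowerSeries.coeff_one] at h1
    by_cases hj : j = 0
    · subst hj
      rw [PowerSeries.coeff_zero_eq_constantCoeff_apply, constantCoeff_normSeries _ hu0,
        if_pos rfl, left_eq_add] at h1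
      rw [h1]
      exact zero_mem _
    · rw [if_neg hj, zero_add] at h1
      rw [← h1]
      exact coeff_normSeries_insL_mem u hu0 hu1 hj
  have h2 := coeff_normSeries_one_add (insL F n L) f k
  rw [hfac, map_mul, hv, mul_add, mul_one, map_add, coeff_normSeries_one_add,
    PowerSeries.coeff_mul] at h2
  rw [← h2, add_sub_cancel_left]
  refine sum_mem fun p _ => ?_
  rw [coeff_normSeries_one_add]
  exact mul_mem_baseChange (fun a ha b hb => mul_mem_elemSubmodule ha hb)
    (esum_insL_mem_baseChange_TS _ _) (hv' _)

theorem lawCoeff_sub_lawCoeff_mem {I : Ideal A} (k : ℕ) {r : ℕ} {a b : Fin r → A}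
    (h : ∀ i, a i - b i ∈ I) (ξ : Fin r →₀ ℕ) :
    lawCoeff (elemLaw F n k) a ξ - lawCoeff (elemLaw F n k) b ξ ∈ elemSubmodule n I := by
  rw [lawCoeff, lawCoeff, ← map_sub, ← map_sub, elemLaw_apply, elemLaw_apply]
  refine lid_rTensor_mem _ (esum_sub_esum_mem k ?_)
  rw [← Finset.sum_sub_distrib]
  refine sum_mem fun i _ => ?_
  rw [← TensorProduct.tmul_sub]
  exact tmul_mem_extIdeal _ (h i)

end Relations

/-! ### Tensor powers of linear maps and the kernel of `A^{⊗n} → (A/I)^{⊗n}`. -/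

section TensorMap

variable {F : Type u} [CommRing F] {A : Type v} [CommRing A] [Algebra F A] {n : ℕ}

/-- The tensor power of a linear endomorphism. -/
def tpowMap (n : ℕ) (φ : A →ₗ[F] A) : TPow F n A →ₗ[F] TPow F n A :=
  PiTensorProduct.map fun _ => φ

theorem tpowMap_tprod (φ : A →ₗ[F] A) (a : Fin n → A) :
    tpowMap n φ (PiTensorProduct.tprod F a) = PiTensorProduct.tprod F fun j => φ (a j) :=
  PiTensorProduct.map_tprod _ _

theorem permHom_tpowMap (φ : A →ₗ[F] A) (σ : Equiv.Perm (Fin n)) (x : TPow F n A) :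
    permHom F n A σ (tpowMap n φ x) = tpowMap n φ (permHom F n A σ x) := by
  induction x using PiTensorProduct.induction_on with
  | smul_tprod r a => simp only [map_smul, tpowMap_tprod, permHom_tprod]
  | add x y hx hy => simp only [map_add, hx, hy]

theorem powMap_tpowMap {B : Type w} [CommRing B] [Algebra F B] (φ : A →ₗ[F] A) (g : A →ₐ[F] B)
    (h : ∀ a, g (φ a) = g a) (x : TPow F n A) : powMap F n g (tpowMap n φ x) = powMap F n g x := by
  induction x using PiTensorProduct.induction_on with
  | smul_tprod r a => simp only [map_smul, tpowMap_tprod, powMap_tprod, h]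
  | add x y hx hy => simp only [map_add, hx, hy]

theorem esum_self_sum_tmul {L : Type w} [CommRing L] [Algebra F L] {r : ℕ} (c : Fin r → L)
    (b : Fin r → A) : esum (insL F n L) n (∑ i, c i ⊗ₜ[F] b i) =
      ∑ g : Fin n → Fin r, (∏ j, c (g j)) ⊗ₜ PiTensorProduct.tprod F fun j => b (g j) := by
  rw [esum_self]
  simp only [map_sum]
  rw [Finset.prod_univ_sum, Fintype.piFinset_univ]
  exact Finset.sum_congr rfl fun g _ => prod_insL_tprod F n L _ _

/-- Although `φ` is only linear, the norm of a sum expands into pure tensors of the `b i`, on which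
its tensor power acts factorwise. -/
theorem tpowMap_lawCoeff (φ : A →ₗ[F] A) {r : ℕ} (b : Fin r → A) (ξ : Fin r →₀ ℕ) :
    tpowMap n φ (lawCoeff (elemLaw F n n) b ξ) =
      lawCoeff (elemLaw F n n) (fun i => φ (b i)) ξ := by
  rw [lawCoeff, ← lid_rTensor_lTensor, elemLaw_apply, lawCoeff, elemLaw_apply,
    esum_self_sum_tmul, esum_self_sum_tmul, map_sum]
  simp only [LinearMap.lTensor_tmul, tpowMap_tprod]

/-- The kernel of `A ⊗ ⋯ ⊗ A → A/I ⊗ ⋯ ⊗ A/I`. -/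
theorem mem_span_ins_of_powMap_eq_zero (I : Ideal A) {x : TPow F n A}
    (hx : powMap F n (Ideal.Quotient.mkₐ F I) x = 0) :
    x ∈ Ideal.span {y | ∃ j, ∃ g ∈ I, y = ins F n j g} := by
  set W : Ideal (TPow F n A) := Ideal.span {y | ∃ j, ∃ g ∈ I, y = ins F n j g} with hW
  -- The insertions descend to `A ⧸ I`, and their product `B` recovers the class modulo `W` from the
  -- image in the tensor power of `A ⧸ I`.
  let h (j : Fin n) : A ⧸ I →ₐ[F] TPow F n A ⧸ W :=
    Ideal.Quotient.liftₐ I ((Ideal.Quotient.mkₐ F W).comp (ins F n j)) fun a ha =>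
      Ideal.Quotient.eq_zero_iff_mem.2 (Ideal.subset_span ⟨j, a, ha, rfl⟩)
  let B : TPow F n (A ⧸ I) →ₗ[F] TPow F n A ⧸ W := PiTensorProduct.lift
    ((MultilinearMap.mkPiAlgebra F (Fin n) (TPow F n A ⧸ W)).compLinearMap
      fun j => (h j).toLinearMap)
  have key : ∀ x, B (powMap F n (Ideal.Quotient.mkₐ F I) x) = Ideal.Quotient.mk W x := by
    intro x
    induction x using PiTensorProduct.induction_on with
    | add x y hx hy => simp only [map_add, hx, hy]
    | smul_tprod r a =>
      rw [map_smul, map_smul, powMap_tprod, PiTensorProduct.lift.tprod]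
      simp only [MultilinearMap.compLinearMap_apply, MultilinearMap.mkPiAlgebra_apply,
        AlgHom.toLinearMap_apply]
      have h1 : ∀ j, h j (Ideal.Quotient.mkₐ F I (a j)) = Ideal.Quotient.mkₐ F W (ins F n j (a j)) :=
        fun j => rfl
      simp only [h1, ← map_prod, ← tprod_eq_prod_ins]
      rw [← map_smul]
      rfl
  rw [← Ideal.Quotient.eq_zero_iff_mem, ← key x, hx, map_zero]

/-- Such an `x` is a finite sum of pure tensors each having a factor in `I`; `G` collects these
factors. -/
theorem exists_finset_of_powMap_eq_zero (I : Ideal A) {x : TPow F n A}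
    (hx : powMap F n (Ideal.Quotient.mkₐ F I) x = 0) :
    ∃ G : Finset A, (∀ g ∈ G, g ∈ I) ∧
      ∀ φ : A →ₗ[F] A, (∀ g ∈ G, φ g = 0) → tpowMap n φ x = 0 := by
  classical
  have hadd : ∀ x y : TPow F n A,
      (∃ G : Finset A, (∀ g ∈ G, g ∈ I) ∧
        ∀ φ : A →ₗ[F] A, (∀ g ∈ G, φ g = 0) → tpowMap n φ x = 0) →
      (∃ G : Finset A, (∀ g ∈ G, g ∈ I) ∧
        ∀ φ : A →ₗ[F] A, (∀ g ∈ G, φ g = 0) → tpowMap n φ y = 0) →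
      ∃ G : Finset A, (∀ g ∈ G, g ∈ I) ∧
        ∀ φ : A →ₗ[F] A, (∀ g ∈ G, φ g = 0) → tpowMap n φ (x + y) = 0 := by
    rintro x y ⟨G, hG, h⟩ ⟨G', hG', h'⟩
    refine ⟨G ∪ G', fun g hg => (Finset.mem_union.1 hg).elim (hG g) (hG' g), fun φ hφ => ?_⟩
    rw [map_add, h φ fun g hg => hφ g (Finset.mem_union_left _ hg),
      h' φ fun g hg => hφ g (Finset.mem_union_right _ hg), add_zero]
  have hx' := mem_span_ins_of_powMap_eq_zero I hx
  obtain ⟨c, hc, rfl⟩ := Submodule.mem_span_set.1 hx'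
  refine Finset.sum_induction _ (fun x => ∃ G : Finset A, (∀ g ∈ G, g ∈ I) ∧
    ∀ φ : A →ₗ[F] A, (∀ g ∈ G, φ g = 0) → tpowMap n φ x = 0) hadd
    ⟨∅, by simp, fun φ _ => map_zero _⟩ fun y hy => ?_
  obtain ⟨j, g, hg, hyg⟩ := hc hy
  change ∃ G : Finset A, _ ∧ ∀ φ : A →ₗ[F] A, _ → tpowMap n φ (c y * y) = 0
  generalize c y = t
  rw [hyg]
  induction t using PiTensorProduct.induction_on with
  | add s t hs ht => rw [add_mul]; exact hadd _ _ hs ht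
  | smul_tprod r a =>
    refine ⟨{a j * g}, fun g' hg' => ?_, fun φ hφ => ?_⟩
    · rw [Finset.mem_singleton.1 hg']
      exact I.mul_mem_left _ hg
    · rw [PiTensorProduct.singleAlgHom_apply, smul_mul_assoc, PiTensorProduct.tprod_mul_tprod,
        map_smul, tpowMap_tprod]
      rw [MultilinearMap.map_coord_zero _ j, smul_zero]
      rw [Pi.mul_apply, MonoidHom.mulSingle_apply, Pi.mulSingle_eq_same]
      exact hφ _ (Finset.mem_singleton_self _)

end TensorMap

/-! ### Symmetric tensors of flat quotients. -/

section Flat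

variable {F : Type u} [CommRing F] {Ω : Type v} {n : ℕ}

/-- The elements of `G` are linear relations in `P/I` among the finitely many monomials of `S`. By
flatness the map `F^S → P/I` factors through a finite free module in which these relations already
hold. Lifting that module to `P` defines `φ` on `S`; on the other monomials `φ` is the identity. -/
theorem exists_linear_of_flat (I : Ideal (MvPolynomial Ω F))
    [Module.Flat F (MvPolynomial Ω F ⧸ I)] (G : Finset (MvPolynomial Ω F))
    (hG : ∀ g ∈ G, g ∈ I) : ∃ φ : MvPolynomial Ω F →ₗ[F] MvPolynomial Ω F,
      (∀ g ∈ G, φ g = 0) ∧ ∀ p, Ideal.Quotient.mkₐ F I (φ p) = Ideal.Quotient.mkₐ F I p := by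
  classical
  let π : MvPolynomial Ω F →ₗ[F] MvPolynomial Ω F ⧸ I := (Ideal.Quotient.mkₐ F I).toLinearMap
  let S : Finset (Ω →₀ ℕ) := G.biUnion MvPolynomial.support
  let j : (S →₀ F) →ₗ[F] MvPolynomial Ω F :=
    Finsupp.linearCombination F fun s => MvPolynomial.monomial s.1 (1 : F)
  let f : (G →₀ F) →ₗ[F] (S →₀ F) :=
    Finsupp.linearCombination F fun g => Finsupp.equivFunOnFinite.symm fun s => g.1.coeff s.1
  have hjf : ∀ g : G, j (f (Finsupp.single g 1)) = g.1 := by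
    intro g
    simp only [f, j, Finsupp.linearCombination_single, one_smul]
    rw [Finsupp.linearCombination_apply, Finsupp.sum_fintype _ _ (by simp)]
    simp only [Finsupp.equivFunOnFinite_symm_apply_apply, MvPolynomial.smul_monomial, smul_eq_mul,
      mul_one]
    rw [Finset.sum_coe_sort S fun s => MvPolynomial.monomial s (g.1.coeff s)]
    conv_rhs => rw [g.1.as_sum]
    refine (Finset.sum_subset (Finset.subset_biUnion_of_mem MvPolynomial.support g.2) ?_).symm
    intro μ _ hμ
    rw [MvPolynomial.notMem_support_iff.1 hμ, map_zero]
  have hzero : (π ∘ₗ j) ∘ₗ f = 0 := by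
    refine Finsupp.lhom_ext' fun g => LinearMap.ext_ring ?_
    simp only [LinearMap.comp_apply, Finsupp.lsingle_apply, hjf]
    exact Ideal.Quotient.eq_zero_iff_mem.2 (hG _ g.2)
  obtain ⟨k, a, y, hxy, haf⟩ := Module.Flat.exists_factorization_of_comp_eq_zero_of_free hzero
  choose b hb using fun i : Fin k => Ideal.Quotient.mk_surjective (y (Finsupp.single i 1))
  let w : (Fin k →₀ F) →ₗ[F] MvPolynomial Ω F := Finsupp.linearCombination F b
  have hw : π ∘ₗ w = y := by
    refine Finsupp.lhom_ext' fun i => LinearMap.ext_ring ?_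
    simp only [LinearMap.comp_apply, Finsupp.lsingle_apply, w, Finsupp.linearCombination_single,
      one_smul]
    exact hb i
  let φ : MvPolynomial Ω F →ₗ[F] MvPolynomial Ω F := (MvPolynomial.basisMonomials Ω F).constr F
    fun μ => if h : μ ∈ S then w (a (Finsupp.single ⟨μ, h⟩ 1)) else MvPolynomial.monomial μ 1
  have hφ : ∀ μ, φ (MvPolynomial.monomial μ 1) =
      if h : μ ∈ S then w (a (Finsupp.single ⟨μ, h⟩ 1)) else MvPolynomial.monomial μ 1 := by
    intro μ
    have := (MvPolynomial.basisMonomials Ω F).constr_basis F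
      (fun μ => if h : μ ∈ S then w (a (Finsupp.single ⟨μ, h⟩ 1)) else MvPolynomial.monomial μ 1) μ
    rwa [MvPolynomial.coe_basisMonomials] at this
  have hφj : φ ∘ₗ j = w ∘ₗ a := by
    refine Finsupp.lhom_ext' fun s => LinearMap.ext_ring ?_
    simp only [LinearMap.comp_apply, Finsupp.lsingle_apply, j, Finsupp.linearCombination_single,
      one_smul, hφ]
    rw [dif_pos s.2]
  have hπφ : π ∘ₗ φ = π := by
    refine (MvPolynomial.basisMonomials Ω F).ext fun μ => ?_
    rw [MvPolynomial.coe_basisMonomials, LinearMap.comp_apply, hφ]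
    split_ifs with h
    · have h1 := LinearMap.congr_fun hw (a (Finsupp.single ⟨μ, h⟩ 1))
      have h2 := LinearMap.congr_fun hxy (Finsupp.single ⟨μ, h⟩ 1)
      rw [LinearMap.comp_apply] at h1
      rw [h1, ← LinearMap.comp_apply, ← h2]
      simp [j]
    · rfl
  refine ⟨φ, fun g hg => ?_, fun p => LinearMap.congr_fun hπφ p⟩
  have h1 := LinearMap.congr_fun hφj (f (Finsupp.single ⟨g, hg⟩ 1))
  have h2 := LinearMap.congr_fun haf (Finsupp.single ⟨g, hg⟩ 1)
  rw [LinearMap.comp_apply, LinearMap.comp_apply, hjf] at h1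
  rw [LinearMap.comp_apply] at h2
  rw [h1, h2, LinearMap.zero_apply, map_zero]

theorem powMap_surjective {A : Type v} [CommRing A] [Algebra F A] {B : Type w} [CommRing B]
    [Algebra F B] {g : A →ₐ[F] B} (hg : Function.Surjective g) :
    Function.Surjective (powMap F n g) := by
  intro y
  induction y using PiTensorProduct.induction_on with
  | add x y hx hy =>
    obtain ⟨x, rfl⟩ := hx
    obtain ⟨y, rfl⟩ := hy
    exact ⟨x + y, map_add _ _ _⟩
  | smul_tprod r b =>
    choose a ha using fun j => hg (b j)
    exact ⟨r • PiTensorProduct.tprod F a, by rw [map_smul, powMap_tprod]; simp only [ha]⟩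

/-- An arbitrary preimage `x₀` is symmetric up to kernel elements `σx₀ - x₀`. A map `φ` adapted to
these finitely many elements makes `φ^{⊗n} x₀` symmetric without changing its image. -/
theorem tsMap_surjective_of_flat (I : Ideal (MvPolynomial Ω F))
    [Module.Flat F (MvPolynomial Ω F ⧸ I)] :
    Function.Surjective (tsMap F n (Ideal.Quotient.mkₐ F I)) := by
  classical
  intro y
  obtain ⟨x₀, hx₀⟩ := powMap_surjective (n := n) (Ideal.Quotient.mkₐ_surjective F I) y.1
  have h1 : ∀ σ : Equiv.Perm (Fin n),
      powMap F n (Ideal.Quotient.mkₐ F I) (permHom F n _ σ x₀ - x₀) = 0 := fun σ => by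
    rw [map_sub, ← permHom_powMap, hx₀, y.2 σ, sub_self]
  choose G hGI hG using fun σ => exists_finset_of_powMap_eq_zero I (h1 σ)
  obtain ⟨φ, hφ, hπ⟩ := exists_linear_of_flat I (Finset.univ.biUnion G) fun g hg => by
    obtain ⟨σ, -, hσ⟩ := Finset.mem_biUnion.1 hg
    exact hGI σ g hσ
  refine ⟨⟨tpowMap n φ x₀, fun σ => ?_⟩, Subtype.ext ?_⟩
  · have h2 := hG σ φ fun g hg => hφ g (Finset.mem_biUnion.2 ⟨σ, Finset.mem_univ _, hg⟩)
    rw [map_sub, sub_eq_zero] at h2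
    rw [permHom_tpowMap, h2]
  · exact (powMap_tpowMap φ _ hπ x₀).trans hx₀

/-- If `P/I` is flat, then the kernel of `TSⁿ(P) → TSⁿ(P/I)` is generated by the `e_k(g)`. -/
theorem mem_elemIdeal_of_flat (I : Ideal (MvPolynomial Ω F))
    [Module.Flat F (MvPolynomial Ω F ⧸ I)] {x : TS F n (MvPolynomial Ω F)}
    (hx : tsMap F n (Ideal.Quotient.mkₐ F I) x = 0) : x ∈ elemIdeal n I := by
  have hx' : powMap F n (Ideal.Quotient.mkₐ F I) x.1 = 0 := congrArg Subtype.val hx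
  obtain ⟨G, hGI, hG⟩ := exists_finset_of_powMap_eq_zero I hx'
  obtain ⟨φ, hφ, hπ⟩ := exists_linear_of_flat I G hGI
  rw [← mem_elemSubmodule, ← sub_zero x.1, ← hG φ hφ]
  have hmem := mem_span_of_mem_TS x.2
  generalize x.1 = y at hmem
  induction hmem using Submodule.span_induction with
  | zero => rw [map_zero, sub_zero]; exact zero_mem _
  | add y z _ _ hy hz => rw [map_add, add_sub_add_comm]; exact add_mem hy hz
  | smul c y _ hy => rw [map_smul, ← smul_sub]; exact Submodule.smul_mem _ _ hy
  | mem y hy =>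
    obtain ⟨r, b, ξ, rfl⟩ := hy
    rw [tpowMap_lawCoeff]
    exact lawCoeff_sub_lawCoeff_mem n (fun i => Ideal.Quotient.eq.1 (hπ (b i)).symm) ξ

end Flat

/-! ### Generators of the kernel of `E → TSⁿ(P/I)`. -/

section Kernel

variable {F : Type u} [CommRing F]

theorem powMap_ins {A : Type v} [CommRing A] [Algebra F A] {B : Type w} [CommRing B] [Algebra F B]
    {n : ℕ} (f : A →ₐ[F] B) (j : Fin n) (a : A) :
    powMap F n f (ins F n j a) = ins F n j (f a) := by
  simp only [PiTensorProduct.singleAlgHom_apply, powMap_tprod, MonoidHom.mulSingle_apply]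
  congr 1
  funext i
  exact Pi.apply_mulSingle (fun _ => f) (fun _ => map_one f) j a i

theorem tsMap_elemSym_eq_zero {A : Type v} [CommRing A] [Algebra F A] {B : Type w} [CommRing B]
    [Algebra F B] {n k : ℕ} (hk : k ≠ 0) (f : A →ₐ[F] B) {g : A} (hg : f g = 0) :
    tsMap F n f (elemSym F n k g) = 0 := by
  refine Subtype.ext ?_
  change powMap F n f (elemSym F n k g : TPow F n A) = 0
  rw [coe_elemSym, esum, map_sum]
  refine Finset.sum_eq_zero fun T hT => ?_
  have hT' : T.Nonempty := by
    rw [← Finset.card_pos, (Finset.mem_powersetCard.1 hT).2]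
    exact Nat.pos_of_ne_zero hk
  obtain ⟨j, hj⟩ := hT'
  rw [map_prod]
  refine Finset.prod_eq_zero hj ?_
  change powMap F n f (ins F n j g) = 0
  rw [powMap_ins, hg, map_zero]

variable {Ω : Type v} {n : ℕ}

theorem kappaQuot_of_mem_liftSet {I : Ideal (MvPolynomial Ω F)}
    {lift : ℕ → MvPolynomial Ω F → ERing F Ω} (hl : IsLifting n I lift) {y : ERing F Ω}
    (hy : y ∈ liftSet n I lift) : kappaQuot n I y = 0 := by
  obtain ⟨k, hk, hkn, g, hg, rfl⟩ := hy
  rw [kappaQuot, AlgHom.comp_apply, hl k hk hkn g hg]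
  exact tsMap_elemSym_eq_zero (Nat.one_le_iff_ne_zero.1 hk) _ (Ideal.Quotient.eq_zero_iff_mem.2 hg)

/-- Surjectivity of `κ_n` makes the image of the ideal of liftings an ideal; the choice of liftings
is therefore immaterial. -/
theorem exists_mem_span_liftSet {I : Ideal (MvPolynomial Ω F)}
    {lift : ℕ → MvPolynomial Ω F → ERing F Ω} (hl : IsLifting n I lift)
    {x : TS F n (MvPolynomial Ω F)} (hx : x ∈ elemIdeal n I) :
    ∃ y ∈ Ideal.span (liftSet n I lift), kappa F Ω n y = x := by
  have h : elemIdeal n I ≤ (Ideal.span (liftSet n I lift)).map (kappa F Ω n) := by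
    rw [Ideal.map_span]
    refine Ideal.span_le.2 ?_
    rintro _ ⟨k, hk, hkn, g, hg, rfl⟩
    exact Ideal.subset_span ⟨lift k g, ⟨k, hk, hkn, g, hg, rfl⟩, hl k hk hkn g hg⟩
  exact (Ideal.mem_map_iff_of_surjective _ (kappa_surjective n)).1 (h hx)

theorem kappaQuot_surjective_of_flat (I : Ideal (MvPolynomial Ω F))
    [Module.Flat F (MvPolynomial Ω F ⧸ I)] : Function.Surjective (kappaQuot n I) := by
  rw [kappaQuot, AlgHom.coe_comp]
  exact (tsMap_surjective_of_flat I).comp (kappa_surjective n)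

theorem ker_kappaQuot_of_flat (I : Ideal (MvPolynomial Ω F))
    [Module.Flat F (MvPolynomial Ω F ⧸ I)] {lift : ℕ → MvPolynomial Ω F → ERing F Ω}
    (hl : IsLifting n I lift) :
    LinearMap.ker (kappaQuot n I).toLinearMap = Submodule.span F (stableCoeffs F Ω n) ⊔
      (Ideal.span (liftSet n I lift)).restrictScalars F := by
  refine le_antisymm (fun y hy => ?_) (sup_le (Submodule.span_le.2 fun y hy => ?_) fun y hy => ?_)
  · obtain ⟨z, hz, hzy⟩ := exists_mem_span_liftSet hl (mem_elemIdeal_of_flat I hy)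
    rw [← sub_add_cancel y z]
    refine Submodule.add_mem_sup ?_ hz
    rw [← ker_kappa]
    change kappa F Ω n (y - z) = 0
    rw [map_sub, hzy]
    exact sub_self _
  · change kappaQuot n I y = 0
    rw [kappaQuot, AlgHom.comp_apply, kappa_of_mem_stableCoeffs hy, map_zero]
  · have h : Ideal.span (liftSet n I lift) ≤ RingHom.ker (kappaQuot n I) :=
      Ideal.span_le.2 fun y hy => kappaQuot_of_mem_liftSet hl hy
    exact h hy

end Kernel

/-! ### Infinite fields: from coefficients of laws to values. -/

section InfiniteField

theorem ground_sum {F : Type u} [CommRing F] {M N : Type*} [AddCommGroup M] [Module F M]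
    [AddCommGroup N] [Module F N] (φ : M →ₚₗ[F] N) {r : ℕ} (a : Fin r → M) (c : Fin r → F) :
    φ.ground (∑ i, c i • a i) = TensorProduct.lid F N
      ((MvPolynomial.aeval (R := F) c).toLinearMap.rTensor N
        (φ.toFun' (MvPolynomial (Fin r) F) (∑ i, MvPolynomial.X i ⊗ₜ[F] a i))) := by
  have h := congrFun (φ.isCompat' (MvPolynomial.aeval (R := F) c))
    (∑ i, MvPolynomial.X i ⊗ₜ[F] a i)
  simp only [Function.comp_apply] at h
  rw [h, map_sum, PolynomialLaw.ground_apply, TensorProduct.tmul_sum]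
  simp only [LinearMap.rTensor_tmul, AlgHom.toLinearMap_apply, MvPolynomial.aeval_X,
    ← TensorProduct.smul_tmul, smul_eq_mul, mul_one]

theorem exists_linearForm_of_notMem {F : Type u} [CommRing F] (hF : IsField F) {N : Type*}
    [AddCommGroup N] [Module F N] {W : Submodule F N} {x : N} (hx : x ∉ W) :
    ∃ l : N →ₗ[F] F, l x ≠ 0 ∧ W ≤ LinearMap.ker l :=
  let _ : Field F := hF.toField
  Submodule.exists_le_ker_of_notMem hx

/-- Over an infinite field, the coefficients of a polynomial law are linear combinations of its
values. -/
theorem lawCoeff_mem_span_range_ground {F : Type u} [CommRing F] [Infinite F] (hF : IsField F)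
    {M N : Type*} [AddCommGroup M] [Module F M] [AddCommGroup N] [Module F N] (φ : M →ₚₗ[F] N)
    {r : ℕ} (a : Fin r → M) (ξ : Fin r →₀ ℕ) :
    lawCoeff φ a ξ ∈ Submodule.span F (Set.range φ.ground) := by
  by_contra hmem
  obtain ⟨l, hl, hle⟩ := exists_linearForm_of_notMem hF hmem
  have := hF.isDomain
  refine hl ?_
  -- A linear form vanishing on all values turns the generic value of `φ` into a polynomial
  -- vanishing at every point of `F^r`. As `F` is an infinite domain, this polynomial is zero.
  have h0 : extForm F (MvPolynomial (Fin r) F) l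
      (φ.toFun' (MvPolynomial (Fin r) F) (∑ i, MvPolynomial.X i ⊗ₜ[F] a i)) = 0 := by
    refine MvPolynomial.funext fun c => ?_
    have h1 : φ.ground (∑ i, c i • a i) ∈ LinearMap.ker l :=
      hle (Submodule.subset_span ⟨_, rfl⟩)
    rw [LinearMap.mem_ker, ground_sum, ← apply_extForm] at h1
    rw [map_zero]
    exact h1
  rw [lawCoeff, ← apply_extForm, h0, map_zero]

variable {F : Type u} [CommRing F] {Ω : Type v} {n : ℕ}

theorem kappa_of_mem_stableValues {y : ERing F Ω} (hy : y ∈ stableValues F Ω n) :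
    kappa F Ω n y = 0 := by
  obtain ⟨m, hm, f, rfl⟩ := hy
  have h := lTensor_kappaT_stableLaw m F (1 ⊗ₜ[F] f) n
  rw [elemLaw_apply, esum_eq_zero _ hm] at h
  rw [mem_ker_kappa, PolynomialLaw.ground_apply]
  have h1 := congrArg (TensorProduct.lid F _) h
  rw [map_zero] at h1
  rw [← h1]
  generalize (stableLaw F Ω m).toFun' F (1 ⊗ₜ[F] f) = z
  induction z with
  | zero => simp only [map_zero]
  | add x y hx hy => simp only [map_add, hx, hy]
  | tmul c y =>
    rw [LinearMap.lTensor_tmul, TensorProduct.lid_tmul, TensorProduct.lid_tmul, map_smul]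
    rfl

theorem span_stableCoeffs_le [Infinite F] (hF : IsField F) :
    Submodule.span F (stableCoeffs F Ω n) ≤
      (Ideal.span (stableValues F Ω n)).restrictScalars F := by
  refine Submodule.span_le.2 ?_
  rintro _ ⟨m, hm, r, a, ξ, rfl⟩
  refine Submodule.span_le.2 ?_ (lawCoeff_mem_span_range_ground hF (stableLaw F Ω m) a ξ)
  rintro _ ⟨f, rfl⟩
  exact Ideal.subset_span ⟨m, hm, f, rfl⟩

theorem ker_kappa_of_infinite [Infinite F] (hF : IsField F) :
    RingHom.ker (kappa F Ω n) = Ideal.span (stableValues F Ω n) := by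
  refine le_antisymm (fun y hy => ?_) (Ideal.span_le.2 fun y hy => kappa_of_mem_stableValues hy)
  have h : y ∈ LinearMap.ker (kappa F Ω n).toLinearMap := hy
  rw [ker_kappa] at h
  exact span_stableCoeffs_le hF h

theorem flat_of_isField (hF : IsField F) (M : Type*) [AddCommGroup M] [Module F M] :
    Module.Flat F M :=
  let _ : Field F := hF.toField
  inferInstance

theorem ker_kappaQuot_of_infinite [Infinite F] (hF : IsField F) (I : Ideal (MvPolynomial Ω F))
    {lift : ℕ → MvPolynomial Ω F → ERing F Ω} (hl : IsLifting n I lift) :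
    RingHom.ker (kappaQuot n I) = Ideal.span (stableValues F Ω n ∪ liftSet n I lift) := by
  have := flat_of_isField hF (MvPolynomial Ω F ⧸ I)
  refine le_antisymm (fun y hy => ?_) (Ideal.span_le.2 ?_)
  · have h : y ∈ LinearMap.ker (kappaQuot n I).toLinearMap := hy
    rw [ker_kappaQuot_of_flat I hl] at h
    obtain ⟨a, ha, b, hb, rfl⟩ := Submodule.mem_sup.1 h
    rw [Ideal.span_union]
    exact add_mem (Ideal.mem_sup_left (span_stableCoeffs_le hF ha)) (Ideal.mem_sup_right hb)
  · rintro y (hy | hy)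
    · change kappaQuot n I y = 0
      rw [kappaQuot, AlgHom.comp_apply, kappa_of_mem_stableValues hy, map_zero]
    · exact kappaQuot_of_mem_liftSet hl hy

end InfiniteField

end SymProd

end

theorem mainTheorem5 {F : Type*} [CommRing F] (Ω : Type*) (n : ℕ) :
    Function.Surjective (SymProd.kappa F Ω n) ∧
    (∀ m : ℕ,
      (∃! φ : SymProd.augIdeal F Ω →ₚₗ[F] SymProd.ERing F Ω, SymProd.IsStableLaw m φ) ∧
      SymProd.IsStableLaw m (SymProd.stableLaw F Ω m) ∧
      SymProd.IsHomogeneousLaw m (SymProd.stableLaw F Ω m)) ∧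
    (∀ I : Ideal (MvPolynomial Ω F), Module.Flat F (MvPolynomial Ω F ⧸ I) →
      Function.Surjective (SymProd.kappaQuot n I) ∧
      ∀ lift : ℕ → MvPolynomial Ω F → SymProd.ERing F Ω, SymProd.IsLifting n I lift →
        LinearMap.ker (SymProd.kappaQuot n I).toLinearMap =
          Submodule.span F (SymProd.stableCoeffs F Ω n) ⊔
            (Ideal.span (SymProd.liftSet n I lift)).restrictScalars F) ∧
    (IsField F → Infinite F →
      RingHom.ker (SymProd.kappa F Ω n) = Ideal.span (SymProd.stableValues F Ω n)) ∧
    (IsField F → Infinite F →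
      ∀ (I : Ideal (MvPolynomial Ω F)) (lift : ℕ → MvPolynomial Ω F → SymProd.ERing F Ω),
        SymProd.IsLifting n I lift →
          RingHom.ker (SymProd.kappaQuot n I) =
            Ideal.span (SymProd.stableValues F Ω n ∪ SymProd.liftSet n I lift)) := by
  refine ⟨SymProd.kappa_surjective n, fun m => ⟨SymProd.existsUnique_isStableLaw m,
    SymProd.isStableLaw_stableLaw m, SymProd.isHomogeneousLaw_stableLaw m⟩,
    fun I _ => ⟨SymProd.kappaQuot_surjective_of_flat I,
      fun _ hl => SymProd.ker_kappaQuot_of_flat I hl⟩,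
    fun hF _ => SymProd.ker_kappa_of_infinite hF,
    fun hF _ I _ hl => SymProd.ker_kappaQuot_of_infinite hF I hl⟩
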